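/- All Hilbert spaces are finite-dimensional and $\log$ is the base-two logarithm. A channel is a completely positive trace-preserving linear map $\mathcal N:\mathcal B(\mathcal H_A)\to\mathcal B(\mathcal H_B)$. It is an entanglement-breaking channel if it is trace-preserving and of the form $\mathcal N(X)=\sum_x N_x\operatorname{Tr}\{M_xX\}$ with a finite sum and positive semidefinite operators $N_x$, $M_x$. For $\alpha>1$ and positive semidefinite $A,B$ let $$\widetilde D_\alpha(A\|B)=\frac1{\alpha-1}\log\widetilde Q_\alpha(A\|B),\qquad \widetilde Q_\alpha(A\|B)=\operatorname{Tr}\left\{\left(B^{\frac{1-\alpha}{2\alpha}}AB^{\frac{1-\alpha}{2\alpha}}\right)^{\alpha}\right\}$$ if $\operatorname{supp}(A)\subseteq\operatorname{supp}(B)$ (negative powers being taken on the support), and $\widetilde Q_\alpha(A\|B)=\infty$ otherwise. The $\alpha$-Holevo information of a channel $\mathcal N$ is $$\widetilde\chi_\alpha(\mathcal N)=\sup_{\{p_X(x),\rho_x\}}\ \inf_{\sigma_B}\ \widetilde D_\alpha(\rho_{XB}\|\rho_X\otimes\sigma_B),$$ $$\rho_{XB}=\sum_x p_X(x)|x\rangle\langle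 x|_X\otimes\mathcal N(\rho_x),\qquad \rho_X=\sum_x p_X(x)|x\rangle\langle x|_X,$$ where the supremum is over all finite ensembles of density operators on $\mathcal H_A$ and the infimum is over all density operators $\sigma_B$ on $\mathcal H_B$ (both are attained when $\mathcal H_A\neq0$). Theorem. For every entanglement-breaking channel $\mathcal N_{\mathrm{EB}}$, every channel $\mathcal N$ and every $\alpha\in(1,2]$, $$\widetilde\chi_\alpha(\mathcal N_{\mathrm{EB}}\otimes\mathcal N)\le\widetilde\chi_\alpha(\mathcal N_{\mathrm{EB}})+\widetilde\chi_\alpha(\mathcal N).$$ -/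

import Mathlib

open scoped Kronecker ComplexOrder

noncomputable section

namespace QInfo

section Operators

variable {n : Type*} [Fintype n] [DecidableEq n]

/-- Density operators: positive semidefinite matrices of trace one. -/
def IsDensity (ρ : Matrix n n ℂ) : Prop :=
  ρ.PosSemidef ∧ ρ.trace = 1

/-- The real power `A ^ s` of a positive semidefinite matrix, for an exponent `s ≠ 0`: by functional
calculus every eigenvalue `t` is replaced by `t ^ s`. Since `(0 : ℝ) ^ s = 0` for `s ≠ 0`, negative
powers are taken on the support of `A`. -/
def matPow (A : Matrix n n ℂ) (s : ℝ) : Matrix n n ℂ :=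
  cfc (fun t : ℝ => t ^ s) A

/-- The support of an operator: the orthogonal complement of its kernel. -/
def supp (A : Matrix n n ℂ) : Submodule ℂ (EuclideanSpace ℂ n) :=
  (LinearMap.ker (Matrix.toEuclideanLin A))ᗮ

open Classical in
/-- The sandwiched quasi-relative entropy
`Tr {(B ^ ((1 - α) / (2 α)) A B ^ ((1 - α) / (2 α))) ^ α}` if `supp A ⊆ supp B`, and `∞` otherwise
(used for positive semidefinite `A`, `B`, for which the trace is real and nonnegative). -/
def sandwichedQuasiEntropy (α : ℝ) (A B : Matrix n n ℂ) : ENNReal :=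
  if supp A ≤ supp B then
    ENNReal.ofReal (Matrix.trace (matPow
      (matPow B ((1 - α) / (2 * α)) * A * matPow B ((1 - α) / (2 * α))) α)).re
  else ⊤

/-- The base two logarithm `[0, ∞] → [-∞, ∞]`, with `log 0 = -∞` and `log ∞ = ∞`. -/
def log₂ (x : ENNReal) : EReal :=
  ENNReal.log x / ((Real.log 2 : ℝ) : EReal)

/-- The sandwiched Rényi relative entropy, with values in the extended reals. -/
def sandwichedRelEntropy (α : ℝ) (A B : Matrix n n ℂ) : EReal :=
  ((1 / (α - 1) : ℝ) : EReal) * log₂ (sandwichedQuasiEntropy α A B)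

end Operators

section Maps

variable {A B C D : Type*} [Fintype A] [DecidableEq A] [Fintype B] [DecidableEq B]
  [Fintype C] [DecidableEq C] [Fintype D] [DecidableEq D]

/-- The tensor product of two linear maps between matrix algebras, the tensor product of two matrix
algebras being identified with the matrices over the product index set by the Kronecker product. -/
def tensorMap (Φ : Matrix A A ℂ →ₗ[ℂ] Matrix B B ℂ) (Ψ : Matrix C C ℂ →ₗ[ℂ] Matrix D D ℂ) :
    Matrix (A × C) (A × C) ℂ →ₗ[ℂ] Matrix (B × D) (B × D) ℂ :=
  (kroneckerLinearEquiv B B D D ℂ).toLinearMap ∘ₗ TensorProduct.map Φ Ψ ∘ₗ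
    (kroneckerLinearEquiv A A C C ℂ).symm.toLinearMap

theorem tensorMap_kronecker (Φ : Matrix A A ℂ →ₗ[ℂ] Matrix B B ℂ)
    (Ψ : Matrix C C ℂ →ₗ[ℂ] Matrix D D ℂ) (X : Matrix A A ℂ) (Y : Matrix C C ℂ) :
    tensorMap Φ Ψ (X ⊗ₖ Y) = Φ X ⊗ₖ Ψ Y := by
  simp [tensorMap]

/-- Complete positivity: `id_R ⊗ Φ` is positive for a reference system `R` of every dimension. -/
def IsCompletelyPositive (Φ : Matrix A A ℂ →ₗ[ℂ] Matrix B B ℂ) : Prop :=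
  ∀ (k : ℕ) (X : Matrix (Fin k × A) (Fin k × A) ℂ), X.PosSemidef →
    (tensorMap (LinearMap.id : Matrix (Fin k) (Fin k) ℂ →ₗ[ℂ] Matrix (Fin k) (Fin k) ℂ) Φ
      X).PosSemidef

/-- Trace preservation. -/
def IsTracePreserving (Φ : Matrix A A ℂ →ₗ[ℂ] Matrix B B ℂ) : Prop :=
  ∀ X : Matrix A A ℂ, (Φ X).trace = X.trace

/-- Quantum channels: completely positive trace-preserving maps. -/
def IsChannel (Φ : Matrix A A ℂ →ₗ[ℂ] Matrix B B ℂ) : Prop :=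
  IsCompletelyPositive Φ ∧ IsTracePreserving Φ

/-- Entanglement-breaking maps: `X ↦ ∑ x, Tr {M x * X} • N x` for finitely many positive
semidefinite operators `M x`, `N x`. -/
def IsEntanglementBreaking (Φ : Matrix A A ℂ →ₗ[ℂ] Matrix B B ℂ) : Prop :=
  ∃ (k : ℕ) (M : Fin k → Matrix A A ℂ) (N : Fin k → Matrix B B ℂ),
    (∀ x, (M x).PosSemidef) ∧ (∀ x, (N x).PosSemidef) ∧
      ∀ X : Matrix A A ℂ, Φ X = ∑ x, (M x * X).trace • N x

/-- Entanglement-breaking channels: trace-preserving entanglement-breaking maps (these maps are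
automatically completely positive). -/
def IsEntanglementBreakingChannel (Φ : Matrix A A ℂ →ₗ[ℂ] Matrix B B ℂ) : Prop :=
  IsEntanglementBreaking Φ ∧ IsTracePreserving Φ

end Maps

section Holevo

variable {A B : Type*} [Fintype A] [DecidableEq A] [Fintype B] [DecidableEq B]

/-- The classical-quantum operator `ρ_XB = ∑ x, p x • |x⟩⟨x| ⊗ ρ x`. -/
def cqState {m : ℕ} (p : Fin m → ℝ) (ρ : Fin m → Matrix B B ℂ) :
    Matrix (Fin m × B) (Fin m × B) ℂ :=
  ∑ x, (p x : ℂ) • (Matrix.single x x (1 : ℂ) ⊗ₖ ρ x)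

/-- The classical marginal `ρ_X = ∑ x, p x • |x⟩⟨x|`. -/
def classicalState {m : ℕ} (p : Fin m → ℝ) : Matrix (Fin m) (Fin m) ℂ :=
  Matrix.diagonal fun x => (p x : ℂ)

/-- The `α`-Holevo information of an ensemble: the infimum of the sandwiched Rényi relative entropy
of `ρ_XB` to `ρ_X ⊗ σ` over all density operators `σ`. -/
def alphaHolevoEnsemble {m : ℕ} (α : ℝ) (p : Fin m → ℝ) (ρ : Fin m → Matrix B B ℂ) : EReal :=
  ⨅ σ : {σ : Matrix B B ℂ // IsDensity σ},
    sandwichedRelEntropy α (cqState p ρ) (classicalState p ⊗ₖ σ.1)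

/-- Finite ensembles of quantum states, `{p_X(x), ρ_x}`. -/
structure Ensemble (A : Type*) [Fintype A] where
  /-- size of the alphabet -/
  size : ℕ
  /-- the probability distribution -/
  prob : Fin size → ℝ
  /-- the states -/
  state : Fin size → Matrix A A ℂ
  prob_nonneg : ∀ x, 0 ≤ prob x
  prob_sum : ∑ x, prob x = 1
  isDensity : ∀ x, IsDensity (state x)

/-- The `α`-Holevo information of a channel: the supremum, over all finite ensembles of input
states, of the `α`-Holevo information of the ensemble of output states. -/
def alphaHolevo (α : ℝ) (Φ : Matrix A A ℂ →ₗ[ℂ] Matrix B B ℂ) : EReal :=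
  ⨆ E : Ensemble A, alphaHolevoEnsemble α E.prob fun x => Φ (E.state x)

end Holevo

end QInfo

end

/-! For a channel `Φ`, write Q(ρ‖σ) for the trace functional `quasi`. For a classical-quantum state
it is linear in the weights: Q(ρ_XB‖ρ_X ⊗ σ) = ∑ p(x) Q(Φ(ρ_x)‖σ). Hence a single σ with Q(Φ(ρ)‖σ) ≤
2^((α-1)c) for all input states ρ gives χ_α(Φ) ≤ c (`alphaHolevo_le`). Conversely, if χ_α(Φ) < c,
every ensemble has its own good σ, and a minimax argument produces one σ good for all inputs
(`exists_posDef_of_alphaHolevo_lt`). So the Holevo information is an information radius, and it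
suffices to show that product reference states multiply the bounds: Q ≤ q for the
entanglement-breaking channel with σ, and Q ≤ r for the other with τ, imply Q ≤ q r for the tensor
product with σ ⊗ τ (`quasi_tensorMap_le`).

The entanglement-breaking form makes the output ∑ N_x ⊗ Ψ(G_x), where G_x is the unnormalised state
on the second system after outcome x, of trace g_x = Tr(M_x ρ₁), with ρ₁ the first marginal.
Sandwiching respects the tensor structure, and the second factors satisfy Tr(R_x^α) ≤ r g_x^α. What
remains is the multiplicativity bound `trPow_sum_kronecker_le`: Tr (∑ N_x ⊗ R_x)^α ≤ r Tr (∑ g_x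
N_x)^α. The last sum is the sandwiched Φ(ρ₁), whose trace power is at most q.

The multiplicativity bound is complex interpolation. With S = ∑ g_x N_x (made invertible), g_x N_x =
S^(1/2) F_x†F_x S^(1/2), normalised D_x and Y = ∑ S^(1/2) F_x†F_x S^(1/2) ⊗ D_x, the function φ(z) =
∑ Tr[(S^(αz/2) F_x†F_x S^(αz/2) ⊗ D_x^(αz)) Y^(α(1-z))] is at most Tr Y^α on re z = 0, at most Tr
S^α on re z = 1, and equals Tr Y^α at z = 1/α. The three lines theorem then gives Tr Y^α ≤ Tr S^α.
-/

noncomputable section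

open scoped MatrixOrder
open Matrix Polynomial

set_option linter.unusedSectionVars false

namespace QInfo

/-! ### Functional calculus of Hermitian matrices by polynomials and diagonalization -/

section SpectralCalculus

variable {n m : Type*} [Fintype n] [DecidableEq n] [Fintype m] [DecidableEq m]

/-- On finitely many points every real function agrees with a polynomial. -/
theorem exists_polynomial_eval_eq (s : Finset ℝ) (f : ℝ → ℝ) :
    ∃ q : ℝ[X], ∀ x ∈ s, q.eval x = f x :=
  ⟨Lagrange.interpolate s id f, fun _ hx =>
    Lagrange.eval_interpolate_at_node (v := id) f (Function.injective_id.injOn) hx⟩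

/-- Spectra are finite here, so interpolation reduces every identity of functional calculus to one
about polynomials, which algebra homomorphisms preserve. -/
theorem cfc_eq_aeval {A : Matrix n n ℂ} (hA : A.IsHermitian) (f : ℝ → ℝ) (q : ℝ[X])
    (hq : ∀ x ∈ spectrum ℝ A, q.eval x = f x) : cfc f A = aeval A q := by
  have hA' : IsSelfAdjoint A := hA
  rw [← cfc_polynomial q A]
  exact cfc_congr fun x hx => (hq x hx).symm

/-- The functional calculus commutes with every algebra homomorphism between matrix algebras. -/
theorem cfc_map_algHom {A : Matrix n n ℂ} (φ : Matrix n n ℂ →ₐ[ℝ] Matrix m m ℂ)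
    (hA : A.IsHermitian) (hB : (φ A).IsHermitian) (f : ℝ → ℝ) : cfc f (φ A) = φ (cfc f A) := by
  classical
  obtain ⟨q, hq⟩ := exists_polynomial_eval_eq
    ((Matrix.finite_real_spectrum (A := A)).toFinset ∪ (Matrix.finite_real_spectrum (A := φ A)).toFinset) f
  rw [cfc_eq_aeval hA f q (fun x hx => hq x (by simp [hx])),
    cfc_eq_aeval hB f q (fun x hx => hq x (by simp [hx])), Polynomial.aeval_algHom_apply]

/-- The functional calculus commutes with every algebra homomorphism from a finite product of matrix
algebras. -/
theorem cfc_map_pi_algHom {ι : Type*} [Fintype ι] {A : ι → Matrix n n ℂ}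
    (φ : (ι → Matrix n n ℂ) →ₐ[ℝ] Matrix m m ℂ)
    (hA : ∀ i, (A i).IsHermitian) (hB : (φ A).IsHermitian) (f : ℝ → ℝ) :
    cfc f (φ A) = φ (fun i => cfc f (A i)) := by
  classical
  obtain ⟨q, hq⟩ := exists_polynomial_eval_eq
    ((Finset.univ.biUnion fun i => (Matrix.finite_real_spectrum (A := A i)).toFinset) ∪
      (Matrix.finite_real_spectrum (A := φ A)).toFinset) f
  rw [cfc_eq_aeval hB f q (fun x hx => hq x (by simp [hx])), Polynomial.aeval_algHom_apply]
  congr 1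
  ext1 i
  rw [cfc_eq_aeval (hA i) f q (fun x hx => hq x (Finset.mem_union_left _
    (Finset.mem_biUnion.2 ⟨i, Finset.mem_univ _, by simpa using hx⟩)))]
  exact (Polynomial.aeval_algHom_apply (Pi.evalAlgHom ℝ (fun _ : ι => Matrix n n ℂ) i) A q).symm

theorem cfc_diagonal (d : n → ℝ) (f : ℝ → ℝ) :
    cfc f (diagonal fun i => (d i : ℂ)) = diagonal fun i => (f (d i) : ℂ) := by
  classical
  have hD : (diagonal fun i => (d i : ℂ)).IsHermitian := by
    rw [Matrix.isHermitian_diagonal_iff]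
    intro i
    simp [isSelfAdjoint_iff]
  obtain ⟨q, hq⟩ := exists_polynomial_eval_eq
    ((Matrix.finite_real_spectrum (A := diagonal fun i => (d i : ℂ))).toFinset ∪ Finset.univ.image d) f
  rw [cfc_eq_aeval hD f q (fun x hx => hq x (by simp [hx]))]
  have h1 : (diagonal fun i => (d i : ℂ)) = Matrix.diagonalAlgHom ℝ (fun i => (d i : ℂ)) := rfl
  rw [h1, Polynomial.aeval_algHom_apply]
  change diagonal _ = _
  congr 1
  ext1 i
  rw [← hq (d i) (by simp)]
  have h2 := Polynomial.aeval_algHom_apply (Pi.evalAlgHom ℝ (fun _ : n => ℂ) i)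
    (fun i => (d i : ℂ)) q
  simp only [Pi.evalAlgHom_apply] at h2
  rw [← h2]
  exact Polynomial.aeval_algebraMap_apply ℂ (d i) q

/-- The functional calculus from any unitary diagonalization. -/
theorem cfc_unitary_diagonal {U : Matrix n n ℂ} (hU : U ∈ unitary (Matrix n n ℂ)) (d : n → ℝ)
    (f : ℝ → ℝ) :
    cfc f (U * diagonal (fun i => (d i : ℂ)) * star U) =
      U * diagonal (fun i => (f (d i) : ℂ)) * star U := by
  have hU' : star U * U = 1 := hU.1
  have hU'' : U * star U = 1 := hU.2
  let φ : Matrix n n ℂ →ₐ[ℝ] Matrix n n ℂ := AlgHom.ofLinearMap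
    ((LinearMap.mulRight ℝ (star U)).comp (LinearMap.mulLeft ℝ U)) (by simp [hU''])
    (fun x y => by
      simp only [LinearMap.comp_apply, LinearMap.mulRight_apply, LinearMap.mulLeft_apply]
      calc U * (x * y) * star U = U * x * (1 * (y * star U)) := by simp [mul_assoc]
        _ = _ := by rw [← hU']; simp only [mul_assoc])
  have hφ : ∀ X, φ X = U * X * star U := fun X => rfl
  have hD : (diagonal fun i => (d i : ℂ)).IsHermitian := by
    rw [Matrix.isHermitian_diagonal_iff]
    intro i
    simp [isSelfAdjoint_iff]
  rw [← hφ, cfc_map_algHom φ hD ?_, cfc_diagonal, hφ]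
  rw [hφ]
  exact Matrix.isHermitian_mul_mul_conjTranspose U hD

theorem spectral_mul_star {A : Matrix n n ℂ} (hA : A.IsHermitian) :
    A = (hA.eigenvectorUnitary : Matrix n n ℂ) * diagonal (fun i => (hA.eigenvalues i : ℂ)) *
      star (hA.eigenvectorUnitary : Matrix n n ℂ) := by
  conv_lhs => rw [hA.spectral_theorem]
  rfl

theorem cfc_eq_mul_star {A : Matrix n n ℂ} (hA : A.IsHermitian) (f : ℝ → ℝ) :
    cfc f A = (hA.eigenvectorUnitary : Matrix n n ℂ) *
      diagonal (fun i => (f (hA.eigenvalues i) : ℂ)) *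
      star (hA.eigenvectorUnitary : Matrix n n ℂ) := by
  rw [hA.cfc_eq]; rfl

theorem trace_cfc {A : Matrix n n ℂ} (hA : A.IsHermitian) (f : ℝ → ℝ) :
    (cfc f A).trace = ((∑ i, f (hA.eigenvalues i) : ℝ) : ℂ) := by
  rw [cfc_eq_mul_star hA, Matrix.trace_mul_comm, ← mul_assoc, Unitary.coe_star_mul_self, one_mul,
    trace_diagonal]
  push_cast
  rfl

/-- `Tr f(A)` depends only on the characteristic polynomial of `A`. -/
theorem trace_cfc_congr {A : Matrix n n ℂ} {B : Matrix n n ℂ} (hA : A.IsHermitian)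
    (hB : B.IsHermitian) (h : A.charpoly = B.charpoly) (f : ℝ → ℝ) :
    (cfc f A).trace = (cfc f B).trace := by
  have h3 : hA.eigenvalues = hB.eigenvalues := 
    (Matrix.IsHermitian.eigenvalues_eq_eigenvalues_iff hA hB).2 h
  rw [trace_cfc hA, trace_cfc hB, h3]

theorem trace_cfc_conjTranspose_mul_self (X : Matrix n n ℂ) (f : ℝ → ℝ) :
    (cfc f (Xᴴ * X)).trace = (cfc f (X * Xᴴ)).trace :=
  trace_cfc_congr (isHermitian_conjTranspose_mul_self X) (isHermitian_mul_conjTranspose_self X)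
    (Matrix.charpoly_mul_comm _ _) f

/-- Traces of products of functions of two Hermitian matrices, in terms of a doubly stochastic
overlap matrix. -/
theorem exists_overlap {A B : Matrix n n ℂ} (hA : A.IsHermitian) (hB : B.IsHermitian) :
    ∃ w : n → n → ℝ, (∀ i j, 0 ≤ w i j) ∧ ∀ f g : ℝ → ℝ, (cfc f A * cfc g B).trace =
      ((∑ i, ∑ j, w i j * (f (hA.eigenvalues i) * g (hB.eigenvalues j)) : ℝ) : ℂ) := by
  set U := (hA.eigenvectorUnitary : Matrix n n ℂ)
  set V := (hB.eigenvectorUnitary : Matrix n n ℂ)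
  refine ⟨fun i j => Complex.normSq ((star U * V) i j), fun i j => Complex.normSq_nonneg _,
    fun f g => ?_⟩
  rw [cfc_eq_mul_star hA, cfc_eq_mul_star hB]
  have h1 : (U * diagonal (fun i => (f (hA.eigenvalues i) : ℂ)) * star U *
      (V * diagonal (fun i => (g (hB.eigenvalues i) : ℂ)) * star V)).trace =
      (diagonal (fun i => (f (hA.eigenvalues i) : ℂ)) * ((star U * V) *
        (diagonal (fun i => (g (hB.eigenvalues i) : ℂ)) * star (star U * V)))).trace := by
    rw [mul_assoc, mul_assoc, Matrix.trace_mul_comm, star_mul, star_star]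
    simp only [mul_assoc]
  rw [h1, Matrix.trace]
  push_cast
  refine Finset.sum_congr rfl fun i _ => ?_
  rw [diag_apply, diagonal_mul, Matrix.mul_apply, Finset.mul_sum]
  refine Finset.sum_congr rfl fun j _ => ?_
  rw [diagonal_mul, star_apply, Complex.normSq_eq_conj_mul_self, ← starRingEnd_apply]
  ring

end SpectralCalculus

/-! ### Real matrix powers and the convexity of A ↦ Tr A^α -/

section MatPow

variable {n m : Type*} [Fintype n] [DecidableEq n] [Fintype m] [DecidableEq m]

theorem spectrum_nonneg {A : Matrix n n ℂ} (hA : A.PosSemidef) {x : ℝ} (hx : x ∈ spectrum ℝ A) :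
    0 ≤ x := by
  rw [hA.1.spectrum_real_eq_range_eigenvalues] at hx
  obtain ⟨i, rfl⟩ := hx
  exact hA.eigenvalues_nonneg i

theorem spectrum_pos {A : Matrix n n ℂ} (hA : A.PosDef) {x : ℝ} (hx : x ∈ spectrum ℝ A) :
    0 < x := by
  rw [hA.1.spectrum_real_eq_range_eigenvalues] at hx
  obtain ⟨i, rfl⟩ := hx
  exact hA.eigenvalues_pos i

theorem cfc_mul_cfc {A : Matrix n n ℂ} (hA : A.IsHermitian) (f g : ℝ → ℝ) :
    cfc f A * cfc g A = cfc (fun x => f x * g x) A := by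
  rw [cfc_eq_mul_star hA, cfc_eq_mul_star hA, cfc_eq_mul_star hA]
  set U := (hA.eigenvectorUnitary : Matrix n n ℂ)
  have hU : star U * U = 1 := Unitary.coe_star_mul_self _
  calc _ = U * diagonal (fun i => (f (hA.eigenvalues i) : ℂ)) * (star U * U) *
        diagonal (fun i => (g (hA.eigenvalues i) : ℂ)) * star U := by simp only [mul_assoc]
    _ = _ := by
      rw [hU, mul_one, mul_assoc U, diagonal_mul_diagonal]
      simp

theorem cfc_posSemidef {A : Matrix n n ℂ} {f : ℝ → ℝ}
    (hf : ∀ x ∈ spectrum ℝ A, 0 ≤ f x) : (cfc f A).PosSemidef :=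
  nonneg_iff_posSemidef.1 (cfc_nonneg hf)

theorem cfc_posSemidef_sub {A : Matrix n n ℂ} (hA : A.IsHermitian) {f g : ℝ → ℝ}
    (hfg : ∀ x ∈ spectrum ℝ A, f x ≤ g x) : (cfc g A - cfc f A).PosSemidef := by
  have hA' : IsSelfAdjoint A := hA
  have hs := Matrix.finite_real_spectrum (A := A)
  exact Matrix.le_iff.1 (cfc_mono hfg (hs.continuousOn f) (hs.continuousOn g))

theorem matPow_posSemidef {A : Matrix n n ℂ} (hA : A.PosSemidef) (s : ℝ) :
    (matPow A s).PosSemidef :=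
  cfc_posSemidef fun _ hx => Real.rpow_nonneg (spectrum_nonneg hA hx) s

theorem matPow_mul_matPow {A : Matrix n n ℂ} (hA : A.PosSemidef) {s t : ℝ} (h : s + t ≠ 0) :
    matPow A s * matPow A t = matPow A (s + t) := by
  rw [matPow, matPow, cfc_mul_cfc hA.1]
  exact cfc_congr fun x hx => (Real.rpow_add' (spectrum_nonneg hA hx) h).symm

theorem matPow_one {A : Matrix n n ℂ} (hA : A.IsHermitian) : matPow A 1 = A := by
  have hA' : IsSelfAdjoint A := hA
  simp only [matPow, Real.rpow_one]
  exact cfc_id' ℝ A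

theorem matPow_posDef_mul_neg {A : Matrix n n ℂ} (hA : A.PosDef) (s : ℝ) :
    matPow A s * matPow A (-s) = 1 := by
  have hA' : IsSelfAdjoint A := hA.1
  rw [matPow, matPow, cfc_mul_cfc hA.1, ← cfc_const_one ℝ A]
  exact cfc_congr fun x hx => by
    rw [← Real.rpow_add (spectrum_pos hA hx)]
    simp

theorem matPow_posDef {A : Matrix n n ℂ} (hA : A.PosDef) (s : ℝ) : (matPow A s).PosDef :=
  (matPow_posSemidef hA.posSemidef s).posDef_iff_isUnit.2
    (IsUnit.of_mul_eq_one _ (matPow_posDef_mul_neg hA s))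

theorem matPow_smul {A : Matrix n n ℂ} (hA : A.PosSemidef) {c : ℝ} (hc : 0 ≤ c) (s : ℝ) :
    matPow ((c : ℂ) • A) s = ((c ^ s : ℝ) : ℂ) • matPow A s := by
  have h := cfc_unitary_diagonal (hA.1.eigenvectorUnitary).2
    (fun i => c * hA.1.eigenvalues i) (fun t => t ^ s)
  have e1 : (hA.1.eigenvectorUnitary : Matrix n n ℂ) *
      diagonal (fun i => ((c * hA.1.eigenvalues i : ℝ) : ℂ)) *
      star (hA.1.eigenvectorUnitary : Matrix n n ℂ) = (c : ℂ) • A := by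
    conv_rhs => rw [spectral_mul_star hA.1]
    rw [← Matrix.smul_mul, ← Matrix.mul_smul, ← diagonal_smul]
    congr 3
    ext1 i
    simp
  rw [e1] at h
  rw [matPow, h, matPow, cfc_eq_mul_star hA.1, ← Matrix.smul_mul, ← Matrix.mul_smul,
    ← diagonal_smul]
  congr 3
  ext1 i
  simp [Real.mul_rpow hc (hA.eigenvalues_nonneg i)]

theorem matPow_kronecker {A : Matrix n n ℂ} {B : Matrix m m ℂ} (hA : A.PosSemidef)
    (hB : B.PosSemidef) (s : ℝ) : matPow (A ⊗ₖ B) s = matPow A s ⊗ₖ matPow B s := by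
  set U := (hA.1.eigenvectorUnitary : Matrix n n ℂ)
  set V := (hB.1.eigenvectorUnitary : Matrix m m ℂ)
  have hU : star U * U = 1 := Unitary.coe_star_mul_self _
  have hV : star V * V = 1 := Unitary.coe_star_mul_self _
  have hUV : star (U ⊗ₖ V) = star U ⊗ₖ star V := conjTranspose_kronecker _ _
  have hW : U ⊗ₖ V ∈ unitary (Matrix (n × m) (n × m) ℂ) := by
    rw [← Matrix.unitaryGroup, Matrix.mem_unitaryGroup_iff', hUV, ← mul_kronecker_mul, hU, hV,
      one_kronecker_one]
  have key : ∀ (a : n → ℝ) (b : m → ℝ), (U * diagonal (fun i => (a i : ℂ)) * star U) ⊗ₖ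
      (V * diagonal (fun i => (b i : ℂ)) * star V) = (U ⊗ₖ V) *
        diagonal (fun p : n × m => ((a p.1 * b p.2 : ℝ) : ℂ)) * star (U ⊗ₖ V) := by
    intro a b
    rw [hUV, mul_kronecker_mul, mul_kronecker_mul, diagonal_kronecker_diagonal]
    simp
  rw [matPow, matPow, matPow, cfc_eq_mul_star hA.1, cfc_eq_mul_star hB.1, key]
  conv_lhs => rw [spectral_mul_star hA.1, spectral_mul_star hB.1]
  rw [key, cfc_unitary_diagonal hW]
  congr 3
  ext1 p
  rw [Real.mul_rpow (hA.eigenvalues_nonneg _) (hB.eigenvalues_nonneg _)]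

/-- The trace `Tr (A ^ s)` of a power of a positive semidefinite matrix, as a real number. -/
def trPow (A : Matrix n n ℂ) (s : ℝ) : ℝ :=
  (matPow A s).trace.re

theorem trPow_nonneg {A : Matrix n n ℂ} (hA : A.PosSemidef) (s : ℝ) : 0 ≤ trPow A s :=
  (Complex.le_def.1 (matPow_posSemidef hA s).trace_nonneg).1

theorem trPow_eq_sum {A : Matrix n n ℂ} (hA : A.IsHermitian) (s : ℝ) :
    trPow A s = ∑ i, hA.eigenvalues i ^ s := by
  rw [trPow, matPow, trace_cfc hA, Complex.ofReal_re]

theorem ofReal_trPow {A : Matrix n n ℂ} (hA : A.IsHermitian) (s : ℝ) :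
    (trPow A s : ℂ) = (matPow A s).trace := by
  rw [trPow, matPow, trace_cfc hA, Complex.ofReal_re]

theorem trPow_conjTranspose_mul_self (X : Matrix n n ℂ) (s : ℝ) :
    trPow (Xᴴ * X) s = trPow (X * Xᴴ) s := by
  rw [trPow, trPow, matPow, matPow, trace_cfc_conjTranspose_mul_self]

theorem trPow_smul {A : Matrix n n ℂ} (hA : A.PosSemidef) {c : ℝ} (hc : 0 ≤ c) (s : ℝ) :
    trPow ((c : ℂ) • A) s = c ^ s * trPow A s := by
  rw [trPow, matPow_smul hA hc, trace_smul, smul_eq_mul, Complex.re_ofReal_mul, trPow]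

theorem trPow_zero {s : ℝ} (hs : s ≠ 0) : trPow (0 : Matrix n n ℂ) s = 0 := by
  have h := trPow_smul (Matrix.PosSemidef.zero (n := n) (R := ℂ)) le_rfl s
  simpa [Real.zero_rpow hs] using h

theorem trace_mul_nonneg {A B : Matrix n n ℂ} (hA : A.PosSemidef) (hB : B.PosSemidef) :
    0 ≤ (A * B).trace := by
  obtain ⟨X, rfl⟩ := CStarAlgebra.nonneg_iff_eq_star_mul_self.1 hA.nonneg
  rw [mul_assoc, Matrix.trace_mul_comm, mul_assoc]
  rw [← mul_assoc]
  exact (hB.mul_mul_conjTranspose_same X).trace_nonneg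

/-- A tangent inequality for the convex trace function `A ↦ Tr (A ^ α)`. -/
theorem trace_matPow_mul_le {A B : Matrix n n ℂ} (hA : A.PosSemidef) (hB : B.PosSemidef) {α : ℝ}
    (hα : 1 < α) :
    α * (A * matPow B (α - 1)).trace.re ≤ trPow A α + (α - 1) * trPow B α := by
  obtain ⟨w, hw, h⟩ := exists_overlap hA.1 hB.1
  have hA' : IsSelfAdjoint A := hA.1
  have hB' : IsSelfAdjoint B := hB.1
  have e1 := h id (fun t => t ^ (α - 1))
  have e2 := h (fun t => t ^ α) (fun _ => 1)
  have e3 := h (fun _ => 1) (fun t => t ^ α)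
  rw [cfc_id ℝ A] at e1
  rw [cfc_const_one ℝ B, mul_one] at e2
  rw [cfc_const_one ℝ A, one_mul] at e3
  rw [trPow, trPow, matPow, matPow, matPow, e1, e2, e3]
  simp only [Complex.ofReal_re, Finset.mul_sum, ← Finset.sum_add_distrib, id]
  refine Finset.sum_le_sum fun i _ => Finset.sum_le_sum fun j _ => ?_
  have hx := hA.eigenvalues_nonneg i
  have hy := hB.eigenvalues_nonneg j
  set x := hA.1.eigenvalues i
  set y := hB.1.eigenvalues j
  have hpq : α.HolderConjugate (α / (α - 1)) := Real.HolderConjugate.conjExponent hα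
  have hY := Real.young_inequality_of_nonneg hx (Real.rpow_nonneg hy (α - 1)) hpq
  rw [← Real.rpow_mul hy, mul_div_cancel₀ _ (by linarith : α - 1 ≠ 0)] at hY
  have h0 : (0 : ℝ) < α := by linarith
  have h0' : (0 : ℝ) < α - 1 := by linarith
  have hY' : α * (x * y ^ (α - 1)) ≤ x ^ α + (α - 1) * y ^ α := by
    have := mul_le_mul_of_nonneg_left hY h0.le
    calc _ ≤ _ := this
      _ = _ := by field_simp
  nlinarith [mul_le_mul_of_nonneg_left hY' (hw i j)]

/-- `A ↦ Tr (A ^ α)` is monotone and convex. -/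
theorem trPow_le_of_le_add {A₁ A₂ B : Matrix n n ℂ} (h₁ : A₁.PosSemidef) (h₂ : A₂.PosSemidef)
    (hB : B.PosSemidef) {a b : ℝ} (ha : 0 ≤ a) (hb : 0 ≤ b) (hab : a + b = 1)
    (h : ((a : ℂ) • A₁ + (b : ℂ) • A₂ - B).PosSemidef) {α : ℝ} (hα : 1 < α) :
    trPow B α ≤ a * trPow A₁ α + b * trPow A₂ α := by
  have hp := matPow_posSemidef hB (α - 1)
  -- Pairing the hypothesis with B^(α-1) gives Tr B^α ≤ a Tr(A₁ B^(α-1)) + b Tr(A₂ B^(α-1)). The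
  -- tangent inequalities at B bound the right side, and the terms (α-1) Tr B^α cancel.
  have k := (Complex.le_def.1 (trace_mul_nonneg h hp)).1
  have e : (B * matPow B (α - 1)).trace.re = trPow B α := by
    nth_rw 1 [← matPow_one hB.1]
    rw [matPow_mul_matPow hB (by linarith), trPow]
    ring_nf
  rw [sub_mul, add_mul, trace_sub, trace_add, Matrix.smul_mul, Matrix.smul_mul, trace_smul,
    trace_smul, Complex.sub_re, Complex.add_re, e, smul_eq_mul, smul_eq_mul,
    Complex.re_ofReal_mul, Complex.re_ofReal_mul, Complex.zero_re] at k
  have k1 := mul_le_mul_of_nonneg_left (trace_matPow_mul_le h₁ hB hα) ha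
  have k2 := mul_le_mul_of_nonneg_left (trace_matPow_mul_le h₂ hB hα) hb
  have hb' : b = 1 - a := by linarith
  subst hb'
  nlinarith

theorem trPow_mono {A B : Matrix n n ℂ} (hA : A.PosSemidef) (hB : B.PosSemidef)
    (h : (A - B).PosSemidef) {α : ℝ} (hα : 1 < α) : trPow B α ≤ trPow A α := by
  have := trPow_le_of_le_add hA hA hB zero_le_one le_rfl (by norm_num) (by simpa using h) hα
  simpa using this

theorem IsDensity.sum_eigenvalues {A : Matrix n n ℂ} (hA : IsDensity A) :
    ∑ i, hA.1.1.eigenvalues i = 1 := by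
  apply Complex.ofReal_injective
  push_cast
  exact (hA.2.symm.trans hA.1.1.trace_eq_sum_eigenvalues).symm

theorem IsDensity.eigenvalues_le_one {A : Matrix n n ℂ} (hA : IsDensity A) (i : n) :
    hA.1.1.eigenvalues i ≤ 1 := by
  rw [← hA.sum_eigenvalues]
  exact Finset.single_le_sum (fun j _ => hA.1.eigenvalues_nonneg j) (Finset.mem_univ i)

theorem trPow_le_one {A : Matrix n n ℂ} (hA : IsDensity A) {α : ℝ} (hα : 1 < α) :
    trPow A α ≤ 1 := by
  rw [trPow_eq_sum hA.1.1, ← hA.sum_eigenvalues]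
  exact Finset.sum_le_sum fun i _ => (Real.rpow_le_rpow_of_exponent_ge' (hA.1.eigenvalues_nonneg i)
    (hA.eigenvalues_le_one i) zero_le_one hα.le).trans_eq (Real.rpow_one _)

end MatPow

/-! ### Complex matrix powers and the three lines theorem -/

section ComplexPow

variable {n m : Type*} [Fintype n] [DecidableEq n] [Fintype m] [DecidableEq m]

/-- The complex power `x ^ z` of a nonnegative real, with value `0` at `x = 0` for every `z`. -/
def suppCpow (x : ℝ) (z : ℂ) : ℂ :=
  if x = 0 then 0 else (x : ℂ) ^ z

theorem suppCpow_mul (x : ℝ) (z w : ℂ) : suppCpow x z * suppCpow x w = suppCpow x (z + w) := by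
  unfold suppCpow
  split_ifs with h
  · simp
  · rw [Complex.cpow_add _ _ (by exact_mod_cast h)]

theorem star_suppCpow {x : ℝ} (hx : 0 ≤ x) (z : ℂ) : star (suppCpow x z) = suppCpow x (star z) := by
  unfold suppCpow
  split_ifs with h
  · simp
  · have := Complex.cpow_conj (x : ℂ) z (by
      rw [Complex.arg_ofReal_of_nonneg hx]; exact Real.pi_pos.ne)
    rw [Complex.conj_ofReal] at this
    exact this.symm

theorem suppCpow_ofReal {x : ℝ} (hx : 0 ≤ x) {s : ℝ} (h : s ≠ 0 ∨ x ≠ 0) :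
    suppCpow x s = ((x ^ s : ℝ) : ℂ) := by
  unfold suppCpow
  split_ifs with h0
  · have hs : s ≠ 0 := h.resolve_right (not_not.2 h0)
    simp [h0, Real.zero_rpow hs]
  · rw [Complex.ofReal_cpow hx]

/-- Complex powers of a positive semidefinite matrix, taken on its support. -/
def complexPow {A : Matrix n n ℂ} (hA : A.IsHermitian) (z : ℂ) : Matrix n n ℂ :=
  (hA.eigenvectorUnitary : Matrix n n ℂ) * diagonal (fun i => suppCpow (hA.eigenvalues i) z) *
    star (hA.eigenvectorUnitary : Matrix n n ℂ)

theorem complexPow_mul {A : Matrix n n ℂ} (hA : A.IsHermitian) (z w : ℂ) :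
    complexPow hA z * complexPow hA w = complexPow hA (z + w) := by
  unfold complexPow
  set U := (hA.eigenvectorUnitary : Matrix n n ℂ)
  have hU : star U * U = 1 := Unitary.coe_star_mul_self _
  calc _ = U * diagonal (fun i => suppCpow (hA.eigenvalues i) z) * (star U * U) *
        diagonal (fun i => suppCpow (hA.eigenvalues i) w) * star U := by simp only [mul_assoc]
    _ = _ := by
      rw [hU, mul_one, mul_assoc U, diagonal_mul_diagonal]
      simp only [suppCpow_mul]

theorem conjTranspose_complexPow {A : Matrix n n ℂ} (hA : A.PosSemidef) (z : ℂ) :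
    (complexPow hA.1 z)ᴴ = complexPow hA.1 (star z) := by
  unfold complexPow
  rw [conjTranspose_mul, conjTranspose_mul, diagonal_conjTranspose, ← star_eq_conjTranspose,
    star_star, ← star_eq_conjTranspose, mul_assoc]
  congr 3
  ext1 i
  exact star_suppCpow (hA.eigenvalues_nonneg i) z

theorem complexPow_ofReal {A : Matrix n n ℂ} (hA : A.PosSemidef) {s : ℝ} (hs : s ≠ 0) :
    complexPow hA.1 s = matPow A s := by
  rw [matPow, cfc_eq_mul_star hA.1, complexPow]
  congr 3
  ext1 i
  exact suppCpow_ofReal (hA.eigenvalues_nonneg i) (Or.inl hs)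

theorem complexPow_zero {A : Matrix n n ℂ} (hA : A.PosDef) :
    complexPow hA.1 0 = 1 := by
  have h : (fun i => suppCpow (hA.1.eigenvalues i) 0) = fun _ => 1 := by
    ext1 i
    simp [suppCpow, (hA.eigenvalues_pos i).ne']
  rw [complexPow, h, diagonal_one, mul_one]
  exact hA.1.eigenvectorUnitary.2.2

/-- Powers live on the support, so the zeroth power is the support projection rather than the
identity. -/
theorem one_sub_complexPow_zero {A : Matrix n n ℂ} (hA : A.IsHermitian) :
    (1 - complexPow hA 0).PosSemidef := by
  have hA' : IsSelfAdjoint A := hA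
  have h : complexPow hA 0 = cfc (fun x : ℝ => if x = 0 then 0 else 1) A := by
    rw [cfc_eq_mul_star hA, complexPow]
    congr 3
    ext1 i
    simp only [suppCpow]
    split_ifs <;> simp
  rw [h, ← cfc_const_one ℝ A]
  refine cfc_posSemidef_sub hA fun x _ => ?_
  split_ifs <;> norm_num

/-- Entire functions that are bounded on the strip `0 ≤ re z ≤ 1`. -/
def IsStripBounded (f : ℂ → ℂ) : Prop :=
  Differentiable ℂ f ∧ ∃ C, ∀ z : ℂ, 0 ≤ z.re → z.re ≤ 1 → ‖f z‖ ≤ C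

theorem IsStripBounded.const (c : ℂ) : IsStripBounded fun _ => c :=
  ⟨differentiable_const c, ‖c‖, fun _ _ _ => le_rfl⟩

theorem IsStripBounded.mul {f g : ℂ → ℂ} (hf : IsStripBounded f) (hg : IsStripBounded g) :
    IsStripBounded fun z => f z * g z := by
  obtain ⟨hf, C, hC⟩ := hf
  obtain ⟨hg, C', hC'⟩ := hg
  refine ⟨hf.mul hg, C * C', fun z h0 h1 => ?_⟩
  rw [norm_mul]
  exact mul_le_mul (hC z h0 h1) (hC' z h0 h1) (norm_nonneg _) ((norm_nonneg _).trans (hC z h0 h1))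

theorem IsStripBounded.sum {ι : Type*} {s : Finset ι} {f : ι → ℂ → ℂ}
    (hf : ∀ i, IsStripBounded (f i)) : IsStripBounded fun z => ∑ i ∈ s, f i z := by
  choose hd C hC using hf
  refine ⟨Differentiable.fun_sum fun i _ => hd i, ∑ i ∈ s, C i, fun z h0 h1 => ?_⟩
  exact (norm_sum_le _ _).trans (Finset.sum_le_sum fun i _ => hC i z h0 h1)

theorem IsStripBounded.suppCpow {x : ℝ} (hx : 0 ≤ x) (a b : ℝ) :
    IsStripBounded fun z => suppCpow x (a * z + b) := by
  unfold QInfo.suppCpow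
  split_ifs with h
  · exact IsStripBounded.const 0
  · have hx' : 0 < x := lt_of_le_of_ne hx (Ne.symm h)
    -- On the strip (x^a)^(re z) lies between 1 and x^a, so x^a + 1 dominates it whichever is
    -- larger.
    refine ⟨?_, (x ^ a + 1) * x ^ b, fun z h0 h1 => ?_⟩
    · intro z
      exact DifferentiableAt.const_cpow (by fun_prop) (Or.inl (by exact_mod_cast h))
    · rw [Complex.norm_cpow_eq_rpow_re_of_pos hx', Complex.add_re, Complex.re_ofReal_mul,
        Complex.ofReal_re, Real.rpow_add hx', Real.rpow_mul hx]
      have hp : 0 < x ^ a := Real.rpow_pos_of_pos hx' a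
      refine mul_le_mul_of_nonneg_right ?_ (Real.rpow_nonneg hx b)
      rcases le_total 1 (x ^ a) with h2 | h2
      · have := Real.rpow_le_rpow_of_exponent_le h2 h1
        rw [Real.rpow_one] at this
        linarith
      · have := Real.rpow_le_one hp.le h2 h0
        linarith

/-- Matrix-valued functions with entries that are entire and bounded on the strip. -/
def IsStripBoundedMatrix (M : ℂ → Matrix n m ℂ) : Prop :=
  ∀ i j, IsStripBounded fun z => M z i j

theorem IsStripBoundedMatrix.const (M : Matrix n m ℂ) :
    IsStripBoundedMatrix fun _ => M :=
  fun i j => IsStripBounded.const (M i j)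

theorem IsStripBoundedMatrix.mul {M M' : ℂ → Matrix n n ℂ} (h : IsStripBoundedMatrix M)
    (h' : IsStripBoundedMatrix M') : IsStripBoundedMatrix fun z => M z * M' z := fun i j => by
  simp only [Matrix.mul_apply]
  exact IsStripBounded.sum fun k => (h i k).mul (h' k j)

theorem IsStripBoundedMatrix.kronecker {M : ℂ → Matrix n n ℂ} {M' : ℂ → Matrix m m ℂ}
    (h : IsStripBoundedMatrix M) (h' : IsStripBoundedMatrix M') :
    IsStripBoundedMatrix fun z => M z ⊗ₖ M' z := fun i j => by
  simp only [kroneckerMap_apply]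
  exact (h i.1 j.1).mul (h' i.2 j.2)

theorem IsStripBoundedMatrix.trace {M : ℂ → Matrix n n ℂ} (h : IsStripBoundedMatrix M) :
    IsStripBounded fun z => (M z).trace :=
  IsStripBounded.sum fun i => h i i

theorem IsStripBoundedMatrix.complexPow {A : Matrix n n ℂ} (hA : A.PosSemidef) (a b : ℝ) :
    IsStripBoundedMatrix fun z => complexPow hA.1 (a * z + b) := by
  refine ((IsStripBoundedMatrix.const _).mul fun i j => ?_).mul (IsStripBoundedMatrix.const _)
  simp only [diagonal_apply]
  split_ifs
  · exact IsStripBounded.suppCpow (hA.eigenvalues_nonneg i) a b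
  · exact IsStripBounded.const 0

/-- The three lines theorem at a real point. -/
theorem IsStripBounded.norm_le {f : ℂ → ℂ} (hf : IsStripBounded f) {a b : ℝ}
    (ha : ∀ y : ℝ, ‖f (y * Complex.I)‖ ≤ a) (hb : ∀ y : ℝ, ‖f (1 + y * Complex.I)‖ ≤ b) {t : ℝ}
    (h0 : 0 ≤ t) (h1 : t ≤ 1) : ‖f t‖ ≤ a ^ (1 - t) * b ^ t := by
  obtain ⟨hd, C, hC⟩ := hf
  have h := Complex.HadamardThreeLines.norm_le_interp_of_mem_verticalClosedStrip₀₁' f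
    (z := (t : ℂ)) (a := a) (b := b)
    ⟨by simpa using h0, by simpa using h1⟩ hd.diffContOnCl ?_ ?_ ?_
  · simpa using h
  · refine ⟨C, ?_⟩
    rintro _ ⟨z, hz, rfl⟩
    exact hC z hz.1 hz.2
  · intro z hz
    have e : z = z.im * Complex.I := by
      apply Complex.ext <;> simp_all
    rw [e]; exact ha _
  · intro z hz
    have e : z = 1 + z.im * Complex.I := by
      apply Complex.ext <;> simp_all
    rw [e]; exact hb _

end ComplexPow

/-! ### A Cauchy–Schwarz bound with a contraction in the middle -/

section TraceInequality

variable {n m : Type*} [Fintype n] [DecidableEq n] [Fintype m] [DecidableEq m]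

/-- Expanding ‖X - wCY‖² ≥ 0 in the Hilbert–Schmidt norm, with the phase w chosen to make the cross
term real, and using ‖CY‖ ≤ ‖Y‖. The arithmetic mean replaces the geometric one because it can be
summed directly. -/
theorem norm_trace_mul_le {X C Y : Matrix n n ℂ} (hC : (1 - Cᴴ * C).PosSemidef) :
    ‖(Xᴴ * C * Y).trace‖ ≤ ((Xᴴ * X).trace.re + (Yᴴ * Y).trace.re) / 2 := by
  set t := (Xᴴ * C * Y).trace with ht
  obtain ⟨w, hw, hwt⟩ : ∃ w : ℂ, star w * w = 1 ∧ w * t = ‖t‖ := by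
    rcases eq_or_ne t 0 with h | h
    · exact ⟨1, by simp, by simp [h]⟩
    · have hn : (‖t‖ : ℂ) ≠ 0 := by exact_mod_cast norm_ne_zero_iff.2 h
      have hs : star t * t = (‖t‖ : ℂ) ^ 2 := by
        rw [Complex.star_def, Complex.conj_mul']
      refine ⟨star t / ‖t‖, ?_, ?_⟩
      · have hr : star (‖t‖ : ℂ) = ‖t‖ := Complex.conj_ofReal _
        rw [star_div₀, star_star, hr]
        field_simp
        rw [mul_comm]; exact hs
      · field_simp
        rw [hs]
  have h1 := (Complex.le_def.1 (posSemidef_conjTranspose_mul_self (X - w • (C * Y))).trace_nonneg).1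
  have h2 := (Complex.le_def.1 (hC.conjTranspose_mul_mul_same Y).trace_nonneg).1
  have e1 : ((X - w • (C * Y))ᴴ * (X - w • (C * Y))).trace =
      (Xᴴ * X).trace + (Yᴴ * (Cᴴ * C) * Y).trace - w * t - star (w * t) := by
    have e2 : star t = (Yᴴ * Cᴴ * X).trace := by
      rw [ht, ← trace_conjTranspose]
      simp [conjTranspose_mul, mul_assoc]
    rw [star_mul', e2, ht, conjTranspose_sub, conjTranspose_smul, conjTranspose_mul, sub_mul,
      mul_sub, mul_sub]
    simp only [trace_sub, Matrix.mul_smul, Matrix.smul_mul, trace_smul, smul_eq_mul, smul_smul,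
      ← mul_assoc]
    rw [mul_comm w (star w), hw]
    ring
  rw [e1, hwt] at h1
  have e3 : Yᴴ * (1 - Cᴴ * C) * Y = Yᴴ * Y - Yᴴ * (Cᴴ * C) * Y := by
    rw [mul_sub, sub_mul, mul_one]
  rw [e3] at h2
  simp only [trace_sub, Complex.sub_re, Complex.add_re, Complex.zero_re, Complex.ofReal_re,
    Complex.star_def, Complex.conj_ofReal] at h1 h2
  linarith

end TraceInequality

/-! ### The interpolating family and its bounds on the two boundary lines -/

section Interpolation

variable {n m ι : Type*} [Fintype n] [DecidableEq n] [Fintype m] [DecidableEq m] [Fintype ι]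

theorem sum_kronecker (A : ι → Matrix n n ℂ) (B : Matrix m m ℂ) :
    (∑ k, A k) ⊗ₖ B = ∑ k, A k ⊗ₖ B := by
  ext i j
  simp [Matrix.sum_apply, Finset.sum_mul]

theorem sub_kronecker (A A' : Matrix n n ℂ) (B : Matrix m m ℂ) :
    (A - A') ⊗ₖ B = A ⊗ₖ B - A' ⊗ₖ B := by
  ext i j
  simp [sub_mul]

theorem kronecker_sub (A : Matrix n n ℂ) (B B' : Matrix m m ℂ) :
    A ⊗ₖ (B - B') = A ⊗ₖ B - A ⊗ₖ B' := by
  ext i j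
  simp [mul_sub]

/-- As P is unitary, the operators F_k P still satisfy ∑ (F_k P)†(F_k P) ≤ 1; tensoring with the
identity and conjugating by K preserves this, and the trace is monotone. -/
theorem sum_trace_compression_le {F : ι → Matrix n n ℂ} (hF : (1 - ∑ k, (F k)ᴴ * F k).PosSemidef)
    {P : Matrix n n ℂ} (hP : Pᴴ * P = 1) (K : Matrix (n × m) (n × m) ℂ) :
    ∑ k, ((((F k * P) ⊗ₖ (1 : Matrix m m ℂ)) * K)ᴴ *
      (((F k * P) ⊗ₖ (1 : Matrix m m ℂ)) * K)).trace.re ≤ (Kᴴ * K).trace.re := by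
  have h := (((hF.conjTranspose_mul_mul_same P).kronecker
    (PosSemidef.one (n := m) (R := ℂ))).conjTranspose_mul_mul_same K).trace_nonneg
  have e : Kᴴ * ((Pᴴ * (1 - ∑ k, (F k)ᴴ * F k) * P) ⊗ₖ (1 : Matrix m m ℂ)) * K =
      Kᴴ * K - ∑ k, (((F k * P) ⊗ₖ (1 : Matrix m m ℂ)) * K)ᴴ *
        (((F k * P) ⊗ₖ (1 : Matrix m m ℂ)) * K) := by
    have e1 : Pᴴ * (1 - ∑ k, (F k)ᴴ * F k) * P = 1 - ∑ k, (F k * P)ᴴ * (F k * P) := by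
      rw [mul_sub, sub_mul, mul_one, hP, Finset.mul_sum, Finset.sum_mul]
      simp only [conjTranspose_mul, mul_assoc]
    have e2 : ∀ k, (((F k * P) ⊗ₖ (1 : Matrix m m ℂ)) * K)ᴴ *
        (((F k * P) ⊗ₖ (1 : Matrix m m ℂ)) * K) =
        Kᴴ * (((F k * P)ᴴ * (F k * P)) ⊗ₖ (1 : Matrix m m ℂ)) * K := by
      intro k
      rw [conjTranspose_mul, conjTranspose_kronecker, conjTranspose_one]
      calc _ = Kᴴ * (((F k * P)ᴴ ⊗ₖ (1 : Matrix m m ℂ)) * ((F k * P) ⊗ₖ (1 : Matrix m m ℂ))) * K := by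
            simp only [mul_assoc]
        _ = _ := by rw [← mul_kronecker_mul, one_mul]
    have e3 : (1 - ∑ k, (F k * P)ᴴ * (F k * P)) ⊗ₖ (1 : Matrix m m ℂ) =
        1 - ∑ k, ((F k * P)ᴴ * (F k * P)) ⊗ₖ (1 : Matrix m m ℂ) := by
      rw [sub_kronecker, sum_kronecker, one_kronecker_one]
    rw [e1, e3, mul_sub, sub_mul, mul_one, Finset.mul_sum, Finset.sum_mul]
    simp only [e2]
  rw [e] at h
  have h' := (Complex.le_def.1 h).1
  rw [trace_sub, trace_sum, Complex.sub_re, Complex.re_sum, Complex.zero_re] at h'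
  linarith

theorem complexPow_conjTranspose_mul_self {A : Matrix n n ℂ} (hA : A.PosSemidef) {s : ℝ}
    (hs : s ≠ 0) {z : ℂ} (hz : star z + z = s) :
    (complexPow hA.1 z)ᴴ * complexPow hA.1 z = matPow A s := by
  rw [conjTranspose_complexPow hA, complexPow_mul, hz, complexPow_ofReal hA hs]

theorem complexPow_mul_conjTranspose_self {A : Matrix n n ℂ} (hA : A.PosSemidef) {s : ℝ}
    (hs : s ≠ 0) {z : ℂ} (hz : star z + z = s) :
    complexPow hA.1 z * (complexPow hA.1 z)ᴴ = matPow A s := by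
  rw [conjTranspose_complexPow hA, complexPow_mul, add_comm, hz, complexPow_ofReal hA hs]

/-- A purely imaginary power is a partial isometry onto the support, hence a contraction even when
the matrix is singular. -/
theorem one_sub_complexPow_imaginary {A : Matrix n n ℂ} (hA : A.PosSemidef) {z : ℂ}
    (hz : star z + z = 0) :
    (1 - (complexPow hA.1 z)ᴴ * complexPow hA.1 z).PosSemidef := by
  rw [conjTranspose_complexPow hA, complexPow_mul, hz]
  exact one_sub_complexPow_zero hA.1

/-- The bound on the line `re z = 0` for the interpolating family. -/
theorem norm_sum_trace_le_trPow {S : Matrix n n ℂ} (hS : S.PosDef) {F : ι → Matrix n n ℂ}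
    (hF : (1 - ∑ k, (F k)ᴴ * F k).PosSemidef) {D : ι → Matrix m m ℂ} (hD : ∀ k, (D k).PosSemidef)
    {Y : Matrix (n × m) (n × m) ℂ} (hY : Y.PosSemidef) {α : ℝ} (hα : 1 < α) {u v w : ℂ}
    (hu : star u + u = 0) (hv : star v + v = 0) (hw : star w + w = 0) :
    ‖∑ k, (((complexPow hS.1 u * ((F k)ᴴ * F k) * complexPow hS.1 u) ⊗ₖ complexPow (hD k).1 v) *
      complexPow hY.1 (α + w)).trace‖ ≤ trPow Y α := by
  have hα0 : α ≠ 0 := by linarith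
  set P := complexPow hS.1 u with hPdef
  set K := complexPow hY.1 (α / 2) with hK
  set L := complexPow hY.1 (α / 2 + w) with hL
  have hPP : Pᴴ * P = 1 := by
    rw [hPdef, conjTranspose_complexPow hS.posSemidef, complexPow_mul, hu, complexPow_zero hS]
  have hPP' : Pᴴᴴ * Pᴴ = 1 := by
    rw [conjTranspose_conjTranspose, hPdef, conjTranspose_complexPow hS.posSemidef, complexPow_mul,
      add_comm, hu, complexPow_zero hS]
  have hhalf : star ((α : ℂ) / 2) = α / 2 := by
    simp
  have hKK : (Kᴴ * K).trace.re = trPow Y α := by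
    rw [hK, complexPow_conjTranspose_mul_self hY hα0 (by rw [hhalf]; ring), trPow]
  have hLL : (Lᴴᴴ * Lᴴ).trace.re = trPow Y α := by
    rw [conjTranspose_conjTranspose, hL, complexPow_mul_conjTranspose_self hY hα0
      (by rw [star_add, hhalf]; linear_combination hw), trPow]
  -- Splitting Y^(α+w) into K L and moving L cyclically to the front exhibits the contraction 1 ⊗
  -- D_k^v between two factors, each of total squared norm at most Tr Y^α.
  have hterm : ∀ k, (((P * ((F k)ᴴ * F k) * P) ⊗ₖ complexPow (hD k).1 v) *
      complexPow hY.1 (α + w)).trace = ((((F k * Pᴴ) ⊗ₖ (1 : Matrix m m ℂ)) * Lᴴ)ᴴ *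
        ((1 : Matrix n n ℂ) ⊗ₖ complexPow (hD k).1 v) *
          (((F k * P) ⊗ₖ (1 : Matrix m m ℂ)) * K)).trace := by
    intro k
    have e1 : complexPow hY.1 (α + w) = K * L := by
      rw [hK, hL, complexPow_mul]; congr 1; ring
    have e2 : (P * ((F k)ᴴ * F k) * P) ⊗ₖ complexPow (hD k).1 v =
        ((P * (F k)ᴴ) ⊗ₖ (1 : Matrix m m ℂ)) * ((1 : Matrix n n ℂ) ⊗ₖ complexPow (hD k).1 v) *
          ((F k * P) ⊗ₖ (1 : Matrix m m ℂ)) := by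
      rw [← mul_kronecker_mul, ← mul_kronecker_mul]
      simp only [mul_assoc, one_mul, mul_one]
    rw [e1, e2, ← mul_assoc, Matrix.trace_mul_comm]
    simp only [conjTranspose_mul, conjTranspose_kronecker, conjTranspose_conjTranspose,
      conjTranspose_one, mul_assoc]
  have hC : ∀ k, (1 - ((1 : Matrix n n ℂ) ⊗ₖ complexPow (hD k).1 v)ᴴ *
      ((1 : Matrix n n ℂ) ⊗ₖ complexPow (hD k).1 v)).PosSemidef := by
    intro k
    have h := (PosSemidef.one (n := n) (R := ℂ)).kronecker (one_sub_complexPow_imaginary (hD k) hv)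
    rw [conjTranspose_kronecker, ← mul_kronecker_mul, conjTranspose_one, one_mul]
    rwa [kronecker_sub, one_kronecker_one] at h
  have hb1 := sum_trace_compression_le hF hPP K
  have hb2 := sum_trace_compression_le hF hPP' Lᴴ
  rw [hKK] at hb1
  rw [hLL] at hb2
  refine (norm_sum_le _ _).trans ((Finset.sum_le_sum fun k _ =>
    (le_of_eq (congrArg norm (hterm k))).trans (norm_trace_mul_le (hC k))).trans ?_)
  rw [← Finset.sum_div, Finset.sum_add_distrib]
  linarith

/-- The bound on the line `re z = 1` for the interpolating family. -/
theorem norm_sum_trace_le_trPow' {S : Matrix n n ℂ} (hS : S.PosDef) {F : ι → Matrix n n ℂ}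
    (hF : (1 - ∑ k, (F k)ᴴ * F k).PosSemidef) {D : ι → Matrix m m ℂ} (hD : ∀ k, (D k).PosSemidef)
    {Y : Matrix (n × m) (n × m) ℂ} (hY : Y.PosSemidef) {α : ℝ} (hα : 1 < α)
    (hDα : ∀ k, trPow (D k) α ≤ 1) {u v w : ℂ}
    (hu : star u + u = 0) (hv : star v + v = 0) (hw : star w + w = 0) :
    ‖∑ k, (((complexPow hS.1 (α / 2 + u) * ((F k)ᴴ * F k) * complexPow hS.1 (α / 2 + u)) ⊗ₖ
      complexPow (hD k).1 (α + v)) * complexPow hY.1 w).trace‖ ≤ trPow S α := by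
  have hα0 : α ≠ 0 := by linarith
  have hhalf : star ((α : ℂ) / 2) = α / 2 := by
    simp
  set P := complexPow hS.1 (α / 2 + u) with hP
  set H := complexPow hY.1 w with hH
  have hPP : Pᴴ * P = matPow S α := complexPow_conjTranspose_mul_self hS.posSemidef hα0
    (by rw [star_add, hhalf]; linear_combination hu)
  have hPP' : P * Pᴴ = matPow S α := complexPow_mul_conjTranspose_self hS.posSemidef hα0
    (by rw [star_add, hhalf]; linear_combination hu)
  have hSα := matPow_posSemidef hS.posSemidef α
  have hfs : ∀ k, (F k * matPow S α * (F k)ᴴ).PosSemidef := fun k =>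
    hSα.mul_mul_conjTranspose_same (F k)
  -- Here the imaginary power H of Y is the contraction. Each outer factor has squared norm Tr(F_k
  -- S^α F_k†) Tr(D_k^α), and the second trace is at most 1.
  have hbound : ∀ k, ‖(((P * ((F k)ᴴ * F k) * P) ⊗ₖ complexPow (hD k).1 (α + v)) * H).trace‖ ≤
      (F k * matPow S α * (F k)ᴴ).trace.re := by
    intro k
    set D₁ := complexPow (hD k).1 (α / 2) with hD₁
    set D₂ := complexPow (hD k).1 (α / 2 + v) with hD₂
    have e1 : complexPow (hD k).1 (α + v) = D₁ * D₂ := by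
      rw [hD₁, hD₂, complexPow_mul]; congr 1; ring
    have e2 : (((P * ((F k)ᴴ * F k) * P) ⊗ₖ complexPow (hD k).1 (α + v)) * H).trace =
        (((P.conjTranspose * (F k)ᴴ) ⊗ₖ D₂ᴴ)ᴴ * H * ((P * (F k)ᴴ) ⊗ₖ D₁)).trace := by
      rw [e1, conjTranspose_kronecker, conjTranspose_mul, conjTranspose_conjTranspose,
        conjTranspose_conjTranspose, conjTranspose_conjTranspose, Matrix.trace_mul_comm _
          ((P * (F k)ᴴ) ⊗ₖ D₁), ← mul_assoc ((P * (F k)ᴴ) ⊗ₖ D₁), ← mul_kronecker_mul]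
      simp only [mul_assoc]
    have e3 : (((Pᴴ * (F k)ᴴ) ⊗ₖ D₂ᴴ)ᴴ * ((Pᴴ * (F k)ᴴ) ⊗ₖ D₂ᴴ)).trace =
        (F k * matPow S α * (F k)ᴴ).trace * (trPow (D k) α : ℝ) := by
      rw [conjTranspose_kronecker, ← mul_kronecker_mul, trace_kronecker, conjTranspose_conjTranspose,
        complexPow_mul_conjTranspose_self (hD k) hα0
          (by rw [star_add, hhalf]; linear_combination hv), ofReal_trPow (hD k).1, ← hPP',
        conjTranspose_mul, conjTranspose_conjTranspose, conjTranspose_conjTranspose]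
      simp only [mul_assoc]
    have e4 : (((P * (F k)ᴴ) ⊗ₖ D₁)ᴴ * ((P * (F k)ᴴ) ⊗ₖ D₁)).trace =
        (F k * matPow S α * (F k)ᴴ).trace * (trPow (D k) α : ℝ) := by
      rw [conjTranspose_kronecker, ← mul_kronecker_mul, trace_kronecker,
        complexPow_conjTranspose_mul_self (hD k) hα0 (by rw [hhalf]; ring),
        ofReal_trPow (hD k).1, ← hPP, conjTranspose_mul, conjTranspose_conjTranspose]
      simp only [mul_assoc]
    have h := norm_trace_mul_le (X := (Pᴴ * (F k)ᴴ) ⊗ₖ D₂ᴴ) (Y := (P * (F k)ᴴ) ⊗ₖ D₁)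
      (one_sub_complexPow_imaginary hY hw)
    rw [e3, e4, Complex.re_mul_ofReal] at h
    rw [e2]
    have h0 := (Complex.le_def.1 (hfs k).trace_nonneg).1
    rw [Complex.zero_re] at h0
    refine h.trans ?_
    nlinarith [mul_le_mul_of_nonneg_left (hDα k) h0]
  calc _ ≤ ∑ k, _ := norm_sum_le _ _
    _ ≤ ∑ k, _ := Finset.sum_le_sum fun k _ => hbound k
    _ ≤ _ := by
      have h := (Complex.le_def.1 (trace_mul_nonneg hF hSα)).1
      rw [sub_mul, one_mul, trace_sub, Finset.sum_mul, trace_sum, Complex.sub_re, Complex.re_sum,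
        Complex.zero_re] at h
      have e : ∀ k, (F k * matPow S α * (F k)ᴴ).trace = ((F k)ᴴ * F k * matPow S α).trace := by
        intro k
        rw [Matrix.trace_mul_comm, ← mul_assoc]
      simp only [e]
      rw [trPow]
      linarith

/-- Three lines applied to φ at the point 1/α gives T ≤ T^(1-1/α) (Tr S^α)^(1/α) with T = Tr Y^α,
which solves to T ≤ Tr S^α. -/
theorem trPow_sum_kronecker_le_of_posDef {S : Matrix n n ℂ} (hS : S.PosDef)
    {F : ι → Matrix n n ℂ} (hF : (1 - ∑ k, (F k)ᴴ * F k).PosSemidef) {D : ι → Matrix m m ℂ}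
    (hD : ∀ k, (D k).PosSemidef) {α : ℝ} (hα : 1 < α) (hDα : ∀ k, trPow (D k) α ≤ 1) :
    trPow (∑ k, (matPow S (1 / 2) * ((F k)ᴴ * F k) * matPow S (1 / 2)) ⊗ₖ D k) α ≤ trPow S α := by
  have hα0 : (0 : ℝ) < α := by linarith
  set Y := ∑ k, (matPow S (1 / 2) * ((F k)ᴴ * F k) * matPow S (1 / 2)) ⊗ₖ D k with hYdef
  have hS2 := matPow_posSemidef hS.posSemidef (1 / 2)
  have hY : Y.PosSemidef := posSemidef_sum _ fun k _ => by
    refine PosSemidef.kronecker ?_ (hD k)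
    have := (posSemidef_conjTranspose_mul_self (F k)).mul_mul_conjTranspose_same (matPow S (1 / 2))
    rwa [hS2.1.eq] at this
  let φ : ℂ → ℂ := fun z => ∑ k, (((complexPow hS.1 ((α / 2 : ℝ) * z + (0 : ℝ)) * ((F k)ᴴ * F k) *
    complexPow hS.1 ((α / 2 : ℝ) * z + (0 : ℝ))) ⊗ₖ complexPow (hD k).1 ((α : ℝ) * z + (0 : ℝ))) *
      complexPow hY.1 ((-α : ℝ) * z + (α : ℝ))).trace
  have hφ : IsStripBounded φ := by
    refine IsStripBounded.sum fun k => IsStripBoundedMatrix.trace (IsStripBoundedMatrix.mul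
      (IsStripBoundedMatrix.kronecker (IsStripBoundedMatrix.mul (IsStripBoundedMatrix.mul
        (IsStripBoundedMatrix.complexPow hS.posSemidef _ _) (IsStripBoundedMatrix.const _))
        (IsStripBoundedMatrix.complexPow hS.posSemidef _ _))
        (IsStripBoundedMatrix.complexPow (hD k) _ _)) (IsStripBoundedMatrix.complexPow hY _ _))
  have him : ∀ a y : ℝ, star ((a : ℂ) * (y * Complex.I)) + (a : ℂ) * (y * Complex.I) = 0 := by
    intro a y
    simp
  have h0 : ∀ y : ℝ, ‖φ (y * Complex.I)‖ ≤ trPow Y α := by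
    intro y
    have := norm_sum_trace_le_trPow hS hF hD hY hα (him (α / 2) y) (him α y) (him (-α) y)
    simpa only [φ, Complex.ofReal_zero, add_zero, add_comm (α : ℂ)] using this
  have h1 : ∀ y : ℝ, ‖φ (1 + y * Complex.I)‖ ≤ trPow S α := by
    intro y
    have := norm_sum_trace_le_trPow' hS hF hD hY hα hDα (him (α / 2) y) (him α y) (him (-α) y)
    have e1 : ((α / 2 : ℝ) : ℂ) * (1 + y * Complex.I) + (0 : ℝ) =
        α / 2 + (α / 2 : ℝ) * (y * Complex.I) := by push_cast; ring
    have e2 : (α : ℂ) * (1 + y * Complex.I) + (0 : ℝ) = α + α * (y * Complex.I) := by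
      push_cast; ring
    have e3 : ((-α : ℝ) : ℂ) * (1 + y * Complex.I) + (α : ℝ) = (-α : ℝ) * (y * Complex.I) := by
      push_cast; ring
    simpa only [φ, e1, e2, e3] using this
  have h := hφ.norm_le h0 h1 (t := 1 / α) (by positivity) ((div_le_one hα0).2 hα.le)
  -- At z = 1/α the exponents of S, D_k and Y become 1/2, 1 and α - 1, so the sum collapses to Tr(Y
  -- · Y^(α-1)).
  have hval : φ ((1 / α : ℝ) : ℂ) = (trPow Y α : ℂ) := by
    have e1 : ((α / 2 : ℝ) : ℂ) * ((1 / α : ℝ) : ℂ) + (0 : ℝ) = ((1 / 2 : ℝ) : ℂ) := by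
      rw [← Complex.ofReal_mul, ← Complex.ofReal_add]; congr 1; field_simp; ring
    have e2 : (α : ℂ) * ((1 / α : ℝ) : ℂ) + (0 : ℝ) = ((1 : ℝ) : ℂ) := by
      rw [← Complex.ofReal_mul, ← Complex.ofReal_add]; congr 1; field_simp; ring
    have e3 : ((-α : ℝ) : ℂ) * ((1 / α : ℝ) : ℂ) + (α : ℝ) = ((α - 1 : ℝ) : ℂ) := by
      rw [← Complex.ofReal_mul, ← Complex.ofReal_add]; congr 1; field_simp; ring
    simp only [φ, e1, e2, e3]
    rw [complexPow_ofReal hS.posSemidef (by norm_num), complexPow_ofReal hY (by linarith)]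
    simp only [complexPow_ofReal (hD _) one_ne_zero, matPow_one (hD _).1]
    rw [← trace_sum, ← Finset.sum_mul, ← hYdef, ofReal_trPow hY.1]
    nth_rw 1 [← matPow_one hY.1]
    rw [matPow_mul_matPow hY (by linarith)]
    congr 2; ring
  have hT := trPow_nonneg hY α
  rw [hval, Complex.norm_real, Real.norm_of_nonneg hT] at h
  -- Solving for T divides by a power of it, so T = 0 is treated apart.
  rcases hT.eq_or_lt with h00 | h00
  · rw [← h00]; exact trPow_nonneg hS.posSemidef α
  · rw [Real.rpow_sub h00, Real.rpow_one, div_mul_eq_mul_div, le_div_iff₀ (by positivity),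
      mul_le_mul_iff_right₀ h00] at h
    exact (Real.rpow_le_rpow_iff hT (trPow_nonneg hS.posSemidef α) (by positivity)).1 h

end Interpolation

/-! ### Multiplicativity for sums of tensor products of positive operators -/

section Multiplicativity

variable {n m ι : Type*} [Fintype n] [DecidableEq n] [Fintype m] [DecidableEq m] [Fintype ι]

theorem eq_zero_of_trPow_nonpos {A : Matrix n n ℂ} (hA : A.PosSemidef) {s : ℝ} (hs : s ≠ 0)
    (h : trPow A s ≤ 0) : A = 0 := by
  rw [← hA.1.eigenvalues_eq_zero_iff]
  rw [trPow_eq_sum hA.1] at h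
  have h0 : ∀ i ∈ Finset.univ, 0 ≤ hA.1.eigenvalues i ^ s := fun i _ =>
    Real.rpow_nonneg (hA.eigenvalues_nonneg i) s
  have h1 := (Finset.sum_eq_zero_iff_of_nonneg h0).1 (le_antisymm h (Finset.sum_nonneg h0))
  ext1 i
  exact (Real.rpow_eq_zero (hA.eigenvalues_nonneg i) hs).1 (h1 i (Finset.mem_univ i))

theorem add_smul_one_eq {A : Matrix n n ℂ} (hA : A.IsHermitian) (ε : ℝ) :
    A + (ε : ℂ) • 1 = (hA.eigenvectorUnitary : Matrix n n ℂ) *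
      diagonal (fun i => ((hA.eigenvalues i + ε : ℝ) : ℂ)) *
      star (hA.eigenvectorUnitary : Matrix n n ℂ) := by
  set U := (hA.eigenvectorUnitary : Matrix n n ℂ) with hU
  have hU'' : U * star U = 1 := hA.eigenvectorUnitary.2.2
  have h : diagonal (fun i => ((hA.eigenvalues i + ε : ℝ) : ℂ)) =
      diagonal (fun i => (hA.eigenvalues i : ℂ)) + (ε : ℂ) • 1 := by
    rw [← diagonal_one, ← diagonal_smul, diagonal_add]
    congr 1
    ext1 i
    simp
  rw [h, mul_add, add_mul, ← spectral_mul_star hA, Matrix.mul_smul, mul_one, Matrix.smul_mul, hU'']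

theorem trPow_add_smul_one {A : Matrix n n ℂ} (hA : A.IsHermitian) (ε s : ℝ) :
    trPow (A + (ε : ℂ) • 1) s = ∑ i, (hA.eigenvalues i + ε) ^ s := by
  rw [trPow, matPow, add_smul_one_eq hA, cfc_unitary_diagonal hA.eigenvectorUnitary.2,
    Matrix.trace_mul_comm, ← mul_assoc, Unitary.coe_star_mul_self, one_mul, trace_diagonal,
    ← Complex.ofReal_sum, Complex.ofReal_re]

/-- Multiplicativity bound for `∑ k, N k ⊗ R k` in the Schatten `α`-norm. -/
theorem trPow_sum_kronecker_le {N : ι → Matrix n n ℂ} {R : ι → Matrix m m ℂ}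
    (hN : ∀ k, (N k).PosSemidef) (hR : ∀ k, (R k).PosSemidef) {g : ι → ℝ} (hg : ∀ k, 0 ≤ g k)
    {c α : ℝ} (hα : 1 < α) (hc : 0 ≤ c) (h : ∀ k, trPow (R k) α ≤ c * g k ^ α) :
    trPow (∑ k, N k ⊗ₖ R k) α ≤ c * trPow (∑ k, (g k : ℂ) • N k) α := by
  have hα0 : (0 : ℝ) < α := by linarith
  have hgN : ∀ k, ((g k : ℂ) • N k).PosSemidef := fun k =>
    (hN k).smul (by exact_mod_cast hg k)
  set S₀ := ∑ k, (g k : ℂ) • N k with hS₀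
  have hS₀p : S₀.PosSemidef := posSemidef_sum _ fun k _ => hgN k
  -- The ε serves twice: it makes S invertible and the constant c + ε positive. It is sent to 0 at
  -- the end by continuity.
  have key : ∀ ε : ℝ, 0 < ε → trPow (∑ k, N k ⊗ₖ R k) α ≤
      (c + ε) * trPow (S₀ + (ε : ℂ) • 1) α := by
    intro ε hε
    have hcε : 0 < c + ε := by linarith
    set S := S₀ + (ε : ℂ) • (1 : Matrix n n ℂ) with hSdef
    have hS : S.PosDef :=
      Matrix.PosDef.posSemidef_add hS₀p (PosDef.one.smul (by exact_mod_cast hε))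
    have hSi := matPow_posSemidef hS.posSemidef (-(1 / 2))
    have hinv : matPow S (1 / 2) * matPow S (-(1 / 2)) = 1 := matPow_posDef_mul_neg hS _
    have hinv' : matPow S (-(1 / 2)) * matPow S (1 / 2) = 1 := by
      simpa using matPow_posDef_mul_neg hS (-(1 / 2))
    have hFF : ∀ k, (matPow ((g k : ℂ) • N k) (1 / 2) * matPow S (-(1 / 2)))ᴴ *
        (matPow ((g k : ℂ) • N k) (1 / 2) * matPow S (-(1 / 2))) =
        matPow S (-(1 / 2)) * ((g k : ℂ) • N k) * matPow S (-(1 / 2)) := by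
      intro k
      have e : matPow ((g k : ℂ) • N k) (1 / 2) * matPow ((g k : ℂ) • N k) (1 / 2) =
          (g k : ℂ) • N k := by
        rw [matPow_mul_matPow (hgN k) (by norm_num)]
        norm_num
        exact matPow_one (hgN k).1
      rw [conjTranspose_mul, hSi.1.eq, (matPow_posSemidef (hgN k) _).1.eq]
      calc _ = matPow S (-(1 / 2)) * (matPow ((g k : ℂ) • N k) (1 / 2) *
            matPow ((g k : ℂ) • N k) (1 / 2)) * matPow S (-(1 / 2)) := by simp only [mul_assoc]
        _ = _ := by rw [e]
    have hF : (1 - ∑ k, (matPow ((g k : ℂ) • N k) (1 / 2) * matPow S (-(1 / 2)))ᴴ *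
        (matPow ((g k : ℂ) • N k) (1 / 2) * matPow S (-(1 / 2)))).PosSemidef := by
      simp only [hFF]
      rw [← Finset.sum_mul, ← Finset.mul_sum, ← hS₀]
      -- Since S - S₀ = ε 1, the defect of ∑ F_k†F_k from the identity is ε S^(-1), which is
      -- positive.
      have e : (1 : Matrix n n ℂ) - matPow S (-(1 / 2)) * S₀ * matPow S (-(1 / 2)) =
          matPow S (-(1 / 2)) * ((ε : ℂ) • 1) * matPow S (-(1 / 2)) := by
        have e1 : matPow S (-(1 / 2)) * S * matPow S (-(1 / 2)) = 1 := by
          have : S = matPow S (1 / 2) * matPow S (1 / 2) := by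
            rw [matPow_mul_matPow hS.posSemidef (by norm_num)]
            norm_num
            exact (matPow_one hS.1).symm
          calc _ = matPow S (-(1 / 2)) * (matPow S (1 / 2) * matPow S (1 / 2)) *
                matPow S (-(1 / 2)) := by rw [← this]
            _ = (matPow S (-(1 / 2)) * matPow S (1 / 2)) * (matPow S (1 / 2) *
                matPow S (-(1 / 2))) := by simp only [mul_assoc]
            _ = 1 := by rw [hinv, hinv', one_mul]
        have e2 : S - S₀ = (ε : ℂ) • 1 := by rw [hSdef, add_sub_cancel_left]
        rw [← e2, mul_sub, sub_mul, e1]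
      rw [e]
      have := ((PosSemidef.one (n := n) (R := ℂ)).smul
        (show (0 : ℂ) ≤ ε by exact_mod_cast hε.le)).mul_mul_conjTranspose_same
          (matPow S (-(1 / 2)))
      rwa [hSi.1.eq] at this
    -- The scaling that turns Tr(R_k^α) ≤ c g_k^α into Tr(D_k^α) ≤ 1. If g_k = 0 the inverse is 0 by
    -- convention and D_k = 0, which is harmless because then R_k = 0.
    let D : ι → Matrix m m ℂ := fun k => (((g k * (c + ε) ^ (1 / α))⁻¹ : ℝ) : ℂ) • R k
    have hci : 0 < (c + ε) ^ (1 / α) := Real.rpow_pos_of_pos hcε _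
    have hciα : ((c + ε) ^ (1 / α)) ^ α = c + ε := by
      rw [← Real.rpow_mul hcε.le, one_div_mul_cancel hα0.ne', Real.rpow_one]
    have hd0 : ∀ k, 0 ≤ (g k * (c + ε) ^ (1 / α))⁻¹ := fun k =>
      inv_nonneg.2 (mul_nonneg (hg k) hci.le)
    have hD : ∀ k, (D k).PosSemidef := fun k => (hR k).smul (by exact_mod_cast hd0 k)
    have hDα : ∀ k, trPow (D k) α ≤ 1 := by
      intro k
      rw [trPow_smul (hR k) (hd0 k)]
      rcases (hg k).eq_or_lt with h0 | h0
      · rw [← h0]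
        simp [Real.zero_rpow hα0.ne']
      · rw [Real.inv_rpow (mul_nonneg (hg k) hci.le), Real.mul_rpow h0.le hci.le, hciα,
          inv_mul_le_iff₀ (by positivity), mul_one]
        refine (h k).trans ?_
        have : 0 < g k ^ α := Real.rpow_pos_of_pos h0 α
        nlinarith
    have hY : ∑ k, N k ⊗ₖ R k = (((c + ε) ^ (1 / α) : ℝ) : ℂ) • ∑ k, (matPow S (1 / 2) *
        ((matPow ((g k : ℂ) • N k) (1 / 2) * matPow S (-(1 / 2)))ᴴ *
        (matPow ((g k : ℂ) • N k) (1 / 2) * matPow S (-(1 / 2)))) * matPow S (1 / 2)) ⊗ₖ D k := by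
      rw [Finset.smul_sum]
      refine Finset.sum_congr rfl fun k _ => ?_
      have e : matPow S (1 / 2) * (matPow S (-(1 / 2)) * ((g k : ℂ) • N k) *
          matPow S (-(1 / 2))) * matPow S (1 / 2) = (g k : ℂ) • N k := by
        calc _ = (matPow S (1 / 2) * matPow S (-(1 / 2))) * ((g k : ℂ) • N k) *
              (matPow S (-(1 / 2)) * matPow S (1 / 2)) := by simp only [mul_assoc]
          _ = _ := by rw [hinv, hinv', one_mul, mul_one]
      rw [hFF, e]
      rcases (hg k).eq_or_lt with h0 | h0
      · have hRk : R k = 0 := eq_zero_of_trPow_nonpos (hR k) hα0.ne' (by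
          have := h k
          rwa [← h0, Real.zero_rpow hα0.ne', mul_zero] at this)
        simp [D, hRk]
      · simp only [D, kronecker_smul, smul_kronecker, smul_smul]
        rw [← Complex.ofReal_mul, ← Complex.ofReal_mul]
        have : (c + ε) ^ (1 / α) * ((g k * (c + ε) ^ (1 / α))⁻¹ * g k) = 1 := by
          field_simp
        rw [this, Complex.ofReal_one, one_smul]
    have hYp : (∑ k, (matPow S (1 / 2) *
        ((matPow ((g k : ℂ) • N k) (1 / 2) * matPow S (-(1 / 2)))ᴴ *
        (matPow ((g k : ℂ) • N k) (1 / 2) * matPow S (-(1 / 2)))) *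
          matPow S (1 / 2)) ⊗ₖ D k).PosSemidef := posSemidef_sum _ fun k _ => by
      refine PosSemidef.kronecker ?_ (hD k)
      have := (posSemidef_conjTranspose_mul_self (matPow ((g k : ℂ) • N k) (1 / 2) *
        matPow S (-(1 / 2)))).mul_mul_conjTranspose_same (matPow S (1 / 2))
      rwa [(matPow_posSemidef hS.posSemidef (1 / 2)).1.eq] at this
    rw [hY, trPow_smul hYp hci.le, hciα]
    exact mul_le_mul_of_nonneg_left (trPow_sum_kronecker_le_of_posDef hS hF hD hα hDα) hcε.le
  have hcont : Continuous fun ε : ℝ => (c + ε) * trPow (S₀ + (ε : ℂ) • 1) α := by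
    simp only [trPow_add_smul_one hS₀p.1]
    refine Continuous.mul (by fun_prop) (continuous_finsetSum _ fun i _ => ?_)
    exact Continuous.rpow_const (by fun_prop) fun _ => Or.inr hα0.le
  have hlim := hcont.continuousWithinAt (s := Set.Ioi 0) (x := 0)
  have := ge_of_tendsto hlim (Filter.eventually_of_mem self_mem_nhdsWithin key)
  simpa using this

end Multiplicativity

/-! ### A minimax principle on compact convex sets -/

section Minimax

/-- If finitely many convex functions on a compact convex set have all their convex combinations
somewhere at most `c`, then the whole family is simultaneously at most `c` at some point. -/
theorem exists_forall_le_of_convex_combinations {E I : Type*} [TopologicalSpace E] [AddCommGroup E]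
    [Module ℝ E] [IsTopologicalAddGroup E] [ContinuousSMul ℝ E] {X : Set E} (hXc : IsCompact X)
    (hXclosed : IsClosed X) (hX : Convex ℝ X) (hne : X.Nonempty) {h : I → E → ℝ}
    (hcont : ∀ i, ContinuousOn (h i) X) (hconv : ∀ i, ConvexOn ℝ X (h i)) {c : ℝ}
    (hc : ∀ (t : Finset I) (p : t → ℝ), (∀ i, 0 ≤ p i) → ∑ i, p i = 1 →
      ∃ x ∈ X, ∑ i, p i * h i x ≤ c) :
    ∃ x ∈ X, ∀ i, h i x ≤ c := by
  classical
  have hfin : ∀ t : Finset I, ∃ x ∈ X, ∀ i ∈ t, h i x ≤ c := by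
    intro t
    rcases t.eq_empty_or_nonempty with rfl | ht
    · obtain ⟨x, hx⟩ := hne
      exact ⟨x, hx, by simp⟩
    have : Nonempty t := ht.to_subtype
    -- A saddle point for the payoff averaged over the simplex of weights. Its first coordinate a
    -- beats every pure weight, because the value at (a, vertex i) is at most the value at (x, b),
    -- and x can be chosen good for b.
    obtain ⟨a, ha, b, hb, hab⟩ := Sion.exists_isSaddlePointOn (X := X) (Y := stdSimplex ℝ t)
      (f := fun x p => ∑ i, p i * h i x) hne hX hXc
      (fun p _ => ContinuousOn.lowerSemicontinuousOn (continuousOn_finsetSum Finset.univ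
        fun (i : t) _ => (continuousOn_const (c := p i)).mul (hcont i)))
      (fun p hp => by
        have : ConvexOn ℝ X (∑ i : t, fun x => p i * h i x) := by
          refine Finset.sum_induction _ (fun f => ConvexOn ℝ X f) (fun _ _ => ConvexOn.add)
            (convexOn_const 0 hX) fun i _ => ?_
          simpa using (hconv i).smul (hp.1 i)
        have e : (fun x => ∑ i : t, p i * h i x) = ∑ i : t, fun x => p i * h i x := by
          funext x
          rw [Finset.sum_apply]
        rw [e]
        exact this.quasiconvexOn)
      (convex_stdSimplex ℝ t) ⟨_, single_mem_stdSimplex ℝ (Classical.arbitrary t)⟩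
      (isCompact_stdSimplex ℝ t)
      (fun x _ => Continuous.continuousOn (by fun_prop) |>.upperSemicontinuousOn)
      (fun x _ => by
        let L : (t → ℝ) →ₗ[ℝ] ℝ := ∑ i : t, (LinearMap.proj i).smulRight (h i x)
        have : (fun p : t → ℝ => ∑ i, p i * h i x) = L := by
          ext p; simp [L]
        rw [this]
        exact (L.concaveOn (convex_stdSimplex ℝ t)).quasiconcaveOn)
    obtain ⟨x, hx, hxc⟩ := hc t b hb.1 hb.2
    refine ⟨a, ha, fun i hi => ?_⟩
    have := hab x hx _ (single_mem_stdSimplex ℝ ⟨i, hi⟩)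
    simp [Pi.single_apply] at this
    simp at hxc
    linarith
  have hclosed : ∀ i, IsClosed (X ∩ h i ⁻¹' Set.Iic c) := fun i =>
    (hcont i).preimage_isClosed_of_isClosed hXclosed isClosed_Iic
  -- Finite subfamilies suffice: the sublevel sets are closed in a compact set, so the finite
  -- intersection property applies.
  obtain ⟨x, hx, hx'⟩ := hXc.inter_iInter_nonempty _ hclosed (fun u => by
    obtain ⟨x, hx, hxu⟩ := hfin u
    exact ⟨x, hx, Set.mem_iInter₂.2 fun i hi => ⟨hx, hxu i hi⟩⟩)
  exact ⟨x, hx, fun i => (Set.mem_iInter.1 hx' i).2⟩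

end Minimax

/-! ### The compact convex set of density operators -/

section Densities

variable {n : Type*} [Fintype n] [DecidableEq n]

open scoped Matrix.Norms.L2Operator

theorem isClosed_setOf_isDensity : IsClosed {σ : Matrix n n ℂ | IsDensity σ} := by
  have h1 : IsClosed {σ : Matrix n n ℂ | 0 ≤ σ} := isClosed_Ici
  have h2 : IsClosed {σ : Matrix n n ℂ | σ.trace = 1} :=
    isClosed_eq (Continuous.matrix_trace continuous_id) continuous_const
  convert h1.inter h2 using 1
  ext σ
  simp [IsDensity, nonneg_iff_posSemidef]

theorem isCompact_setOf_isDensity : IsCompact {σ : Matrix n n ℂ | IsDensity σ} := by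
  refine Metric.isCompact_of_isClosed_isBounded isClosed_setOf_isDensity ?_
  refine (Metric.isBounded_closedBall (x := (0 : Matrix n n ℂ)) (r := 1)).subset ?_
  intro σ hσ
  have hσ' : IsSelfAdjoint σ := hσ.1.1
  rw [mem_closedBall_zero_iff, CStarAlgebra.norm_le_one_iff_of_nonneg σ hσ.1.nonneg, Matrix.le_iff]
  rw [← cfc_const_one ℝ σ]
  nth_rw 2 [← cfc_id ℝ σ]
  refine cfc_posSemidef_sub hσ.1.1 fun x hx => ?_
  rw [hσ.1.1.spectrum_real_eq_range_eigenvalues] at hx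
  obtain ⟨i, rfl⟩ := hx
  exact hσ.eigenvalues_le_one i

theorem convex_setOf_isDensity : Convex ℝ {σ : Matrix n n ℂ | IsDensity σ} := by
  intro σ hσ τ hτ a b ha hb hab
  refine ⟨(hσ.1.smul ha).add (hτ.1.smul hb), ?_⟩
  rw [trace_add, trace_smul, trace_smul, hσ.2, hτ.2, ← add_smul, hab, one_smul]

/-- The maximally mixed state. -/
def maxMixed (n : Type*) [Fintype n] [DecidableEq n] : Matrix n n ℂ :=
  ((Fintype.card n : ℝ)⁻¹ : ℝ) • 1

theorem maxMixed_posDef [Nonempty n] : (maxMixed n).PosDef :=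
  PosDef.one.smul (inv_pos.2 (by exact_mod_cast Fintype.card_pos))

theorem maxMixed_isDensity [Nonempty n] : IsDensity (maxMixed n) := by
  refine ⟨maxMixed_posDef.posSemidef, ?_⟩
  have : (Fintype.card n : ℂ) ≠ 0 := by exact_mod_cast Fintype.card_ne_zero
  rw [maxMixed, trace_smul, trace_one, Complex.real_smul]
  push_cast
  field_simp

end Densities

/-! ### Convexity and continuity of the quasi-entropy in the reference state -/

section Quasi

variable {n : Type*} [Fintype n] [DecidableEq n]

open scoped Matrix.Norms.L2Operator

/-- The trace functional in the sandwiched quasi-relative entropy. -/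
def quasi (α : ℝ) (ρ σ : Matrix n n ℂ) : ℝ :=
  trPow (matPow σ ((1 - α) / (2 * α)) * ρ * matPow σ ((1 - α) / (2 * α))) α

/-- X†X and XX† have the same trace powers; with X = ρ^(1/2) σ^((1-α)/(2α)) the two outer powers of
σ merge into one inner power, so that order and convexity properties of σ ↦ σ^(-(α-1)/α) become
usable. -/
theorem quasi_eq {ρ σ : Matrix n n ℂ} (hρ : ρ.PosSemidef) (hσ : σ.PosSemidef) {α : ℝ}
    (hα : 1 < α) :
    quasi α ρ σ = trPow (matPow ρ (1 / 2) * matPow σ (-((α - 1) / α)) * matPow ρ (1 / 2)) α := by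
  have hr := matPow_posSemidef hρ (1 / 2)
  have hs := matPow_posSemidef hσ ((1 - α) / (2 * α))
  have h := trPow_conjTranspose_mul_self (matPow ρ (1 / 2) * matPow σ ((1 - α) / (2 * α))) α
  rw [conjTranspose_mul, hr.1.eq, hs.1.eq] at h
  have hα0 : α ≠ 0 := by linarith
  have hα1 : α - 1 ≠ 0 := by linarith
  have e1 : (1 - α) / (2 * α) + (1 - α) / (2 * α) = -((α - 1) / α) := by field_simp; ring
  have e2 : matPow ρ (1 / 2) * matPow ρ (1 / 2) = ρ := by
    rw [matPow_mul_matPow hρ (by norm_num)]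
    norm_num
    exact matPow_one hρ.1
  have e3 : matPow σ ((1 - α) / (2 * α)) * matPow σ ((1 - α) / (2 * α)) =
      matPow σ (-((α - 1) / α)) := by
    rw [matPow_mul_matPow hσ (by rw [e1]; exact neg_ne_zero.2 (div_ne_zero hα1 hα0)), e1]
  rw [quasi]
  nth_rw 1 [← e2]
  rw [← e3]
  simpa only [mul_assoc] using h

theorem matPow_sandwich_posSemidef {ρ σ : Matrix n n ℂ} (hρ : ρ.PosSemidef) (hσ : σ.PosSemidef)
    (r s : ℝ) : (matPow ρ r * matPow σ s * matPow ρ r).PosSemidef := by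
  have := (matPow_posSemidef hσ s).mul_mul_conjTranspose_same (matPow ρ r)
  rwa [(matPow_posSemidef hρ r).1.eq] at this

theorem rpow_eq_matPow {A : Matrix n n ℂ} (hA : A.PosSemidef) (s : ℝ) : A ^ s = matPow A s := by
  rw [CFC.rpow_eq_cfc_real hA.nonneg]
  rfl

theorem matPow_neg_eq_inverse {A : Matrix n n ℂ} (hA : A.PosDef) (s : ℝ) :
    matPow A (-s) = Ring.inverse (matPow A s) := by
  have h1 := matPow_posDef_mul_neg hA s
  have h2 := matPow_posDef_mul_neg hA (-s)
  rw [neg_neg] at h2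
  exact (Ring.inverse_unit (⟨matPow A s, matPow A (-s), h1, h2⟩ : (Matrix n n ℂ)ˣ)).symm

/-- Operator convexity of `σ ↦ σ ^ (-s)` for `0 ≤ s ≤ 1`. -/
theorem matPow_neg_convex {σ τ : Matrix n n ℂ} (hσ : σ.PosDef) (hτ : τ.PosDef) {a b s : ℝ}
    (ha : 0 ≤ a) (hb : 0 ≤ b) (hab : a + b = 1) (hs : s ∈ Set.Icc (0 : ℝ) 1) :
    (a • matPow σ (-s) + b • matPow τ (-s) - matPow (a • σ + b • τ) (-s)).PosSemidef := by
  have hστ : (a • σ + b • τ).PosDef := by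
    have h := (CStarAlgebra.convexOn_ringInverse (A := Matrix n n ℂ)).1
      hσ.isStrictlyPositive hτ.isStrictlyPositive ha hb hab
    exact IsStrictlyPositive.posDef h
  have h1 := (CFC.concaveOn_rpow (A := Matrix n n ℂ) hs).2 hσ.posSemidef.nonneg
    hτ.posSemidef.nonneg ha hb hab
  simp only [rpow_eq_matPow hσ.posSemidef, rpow_eq_matPow hτ.posSemidef,
    rpow_eq_matPow hστ.posSemidef] at h1
  have h2 := (CStarAlgebra.convexOn_ringInverse (A := Matrix n n ℂ))
  have hpσ := (matPow_posDef hσ s).isStrictlyPositive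
  have hpτ := (matPow_posDef hτ s).isStrictlyPositive
  -- The power s is operator concave, and inversion is order-reversing and operator convex;
  -- composing the two gives convexity of the power -s.
  have h3 := CStarAlgebra.ringInverse_le_ringInverse h1 (h2.1 hpσ hpτ ha hb hab)
  rw [matPow_neg_eq_inverse hσ, matPow_neg_eq_inverse hτ, matPow_neg_eq_inverse hστ,
    ← Matrix.le_iff]
  exact h3.trans (h2.2 hpσ hpτ ha hb hab)

/-- For α > 1 the exponent (α-1)/α lies in [0, 1], so the inner negative power is operator convex,
and Tr (·)^α is monotone and convex. -/
theorem quasi_convex {ρ σ τ : Matrix n n ℂ} (hρ : ρ.PosSemidef) (hσ : σ.PosDef) (hτ : τ.PosDef)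
    {a b α : ℝ} (hα : 1 < α) (ha : 0 ≤ a) (hb : 0 ≤ b) (hab : a + b = 1)
    (hστ : (a • σ + b • τ).PosSemidef) :
    quasi α ρ (a • σ + b • τ) ≤ a * quasi α ρ σ + b * quasi α ρ τ := by
  have hs : (α - 1) / α ∈ Set.Icc (0 : ℝ) 1 := by
    have : 0 < α := by linarith
    exact ⟨div_nonneg (by linarith) this.le, (div_le_one this).2 (by linarith)⟩
  rw [quasi_eq hρ hσ.posSemidef hα, quasi_eq hρ hτ.posSemidef hα, quasi_eq hρ hστ hα]
  refine trPow_le_of_le_add (matPow_sandwich_posSemidef hρ hσ.posSemidef _ _)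
    (matPow_sandwich_posSemidef hρ hτ.posSemidef _ _) (matPow_sandwich_posSemidef hρ hστ _ _)
    ha hb hab ?_ hα
  have h := (matPow_neg_convex hσ hτ ha hb hab hs).mul_mul_conjTranspose_same (matPow ρ (1 / 2))
  rw [(matPow_posSemidef hρ (1 / 2)).1.eq] at h
  convert h using 1
  rw [mul_sub, sub_mul, mul_add, add_mul]
  simp only [Matrix.mul_smul, Matrix.smul_mul, Complex.coe_smul]

theorem quasi_continuousOn {ρ : Matrix n n ℂ} (hρ : ρ.PosSemidef) {α : ℝ} (hα : 1 < α) :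
    ContinuousOn (quasi α ρ) {σ : Matrix n n ℂ | σ.PosDef} := by
  have h1 : ContinuousOn (fun σ : Matrix n n ℂ => matPow σ ((1 - α) / (2 * α)))
      {σ : Matrix n n ℂ | σ.PosDef} := by
    refine ContinuousOn.cfc_of_mem_nhdsSet (s := Set.Ioi 0) _ ?_ continuousOn_id
      (fun σ hσ => hσ.1) (fun x hx => (Real.continuousAt_rpow_const x _
        (Or.inl (ne_of_gt hx))).continuousWithinAt)
    rw [isOpen_Ioi.mem_nhdsSet]
    exact Set.iUnion₂_subset fun σ hσ x hx => spectrum_pos hσ hx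
  have h2 : ContinuousOn (fun σ : Matrix n n ℂ => matPow σ ((1 - α) / (2 * α)) * ρ *
      matPow σ ((1 - α) / (2 * α))) {σ : Matrix n n ℂ | σ.PosDef} :=
    (h1.mul continuousOn_const).mul h1
  have h3 : ContinuousOn (fun σ : Matrix n n ℂ => matPow (matPow σ ((1 - α) / (2 * α)) * ρ *
      matPow σ ((1 - α) / (2 * α))) α) {σ : Matrix n n ℂ | σ.PosDef} := by
    refine ContinuousOn.cfc_of_mem_nhdsSet (s := Set.univ) _ Filter.univ_mem h2
      (fun σ hσ => ?_) (Real.continuous_rpow_const (by linarith)).continuousOn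
    have := hρ.mul_mul_conjTranspose_same (matPow σ ((1 - α) / (2 * α)))
    rw [(matPow_posSemidef hσ.posSemidef _).1.eq] at this
    exact this.1
  exact Complex.continuous_re.comp_continuousOn
    ((Continuous.matrix_trace continuous_id).comp_continuousOn h3)

end Quasi

/-! ### Support conditions and perturbation towards the maximally mixed state -/

section Regularization

variable {n : Type*} [Fintype n] [DecidableEq n]

/-- Orthogonal complementation reverses inclusion, so the support condition is an inclusion of
kernels. -/
theorem supp_le_supp_iff {A B : Matrix n n ℂ} :
    supp A ≤ supp B ↔ ∀ v : n → ℂ, B *ᵥ v = 0 → A *ᵥ v = 0 := by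
  rw [supp, supp, Submodule.orthogonal_le_orthogonal_iff]
  constructor
  · intro h v hv
    have : WithLp.toLp 2 v ∈ LinearMap.ker (Matrix.toEuclideanLin B) := by
      rw [LinearMap.mem_ker, Matrix.toLpLin_toLp, Matrix.toLin'_apply, hv]; rfl
    have := h this
    rw [LinearMap.mem_ker, Matrix.toLpLin_toLp] at this
    exact congrArg WithLp.ofLp this
  · intro h v hv
    rw [LinearMap.mem_ker, Matrix.toLpLin_apply] at hv ⊢
    rw [h _ (congrArg WithLp.ofLp hv)]; rfl

theorem PosDef.mulVec_eq_zero {A : Matrix n n ℂ} (hA : A.PosDef) {v : n → ℂ} (h : A *ᵥ v = 0) :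
    v = 0 := by
  by_contra hv
  have := hA.dotProduct_mulVec_pos hv
  rw [h, dotProduct_zero] at this
  exact lt_irrefl _ this

theorem cfc_cfc {A : Matrix n n ℂ} (hA : A.IsHermitian) (f g : ℝ → ℝ) :
    cfc g (cfc f A) = cfc (fun x => g (f x)) A := by
  rw [cfc_eq_mul_star hA f, cfc_unitary_diagonal hA.eigenvectorUnitary.2 _ g]
  exact (cfc_eq_mul_star hA fun x => g (f x)).symm

theorem quasi_smul {ρ σ : Matrix n n ℂ} (hρ : ρ.PosSemidef) (hσ : σ.PosSemidef) {c : ℝ}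
    (hc : 0 ≤ c) (α : ℝ) : quasi α ((c : ℂ) • ρ) σ = c ^ α * quasi α ρ σ := by
  have h := hρ.mul_mul_conjTranspose_same (matPow σ ((1 - α) / (2 * α)))
  rw [(matPow_posSemidef hσ _).1.eq] at h
  rw [quasi, Matrix.mul_smul, Matrix.smul_mul, trPow_smul h hc, quasi]

/-- Mixing the reference state with the maximally mixed state costs at most a constant factor. -/
theorem quasi_mix_le [Nonempty n] {ρ σ : Matrix n n ℂ} (hρ : ρ.PosSemidef) (hσ : σ.PosSemidef)
    (hs : supp ρ ≤ supp σ) {α δ : ℝ} (hα : 1 < α) (hδ0 : 0 < δ) (hδ1 : δ < 1) :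
    quasi α ρ ((1 - δ) • σ + δ • maxMixed n) ≤ (1 - δ) ^ (1 - α) * quasi α ρ σ := by
  have hα0 : (0 : ℝ) < α := by linarith
  set e : ℝ := δ * (Fintype.card n : ℝ)⁻¹ with he
  have he0 : 0 < e := mul_pos hδ0 (inv_pos.2 (by exact_mod_cast Fintype.card_pos))
  have h1δ : 0 < 1 - δ := by linarith
  set t : ℝ := (α - 1) / α with ht
  set τ := (1 - δ) • σ + δ • maxMixed n with hτdef
  have hτ : τ = cfc (fun x => (1 - δ) * x + e) σ := by
    rw [cfc_eq_aeval hσ.1 _ (C (1 - δ) * X + C e) (by simp)]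
    simp only [map_add, map_mul, aeval_C, aeval_X, hτdef, maxMixed, smul_smul, ← he,
      Algebra.algebraMap_eq_smul_one, Matrix.smul_mul, one_mul]
  have hτp : τ.PosSemidef := (hσ.smul h1δ.le).add (maxMixed_posDef.posSemidef.smul hδ0.le)
  have hτt : matPow τ (-t) = cfc (fun x => ((1 - δ) * x + e) ^ (-t)) σ := by
    rw [matPow, hτ, cfc_cfc hσ.1]
  -- The support projection of σ. It fixes ρ^(1/2), so negative powers need only be compared on the
  -- support; off it, the power of the mixed state is large while that of σ is 0 by convention.
  set P : Matrix n n ℂ := cfc (fun x : ℝ => if x = 0 then 0 else 1) σ with hP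
  have hσ' : IsSelfAdjoint σ := hσ.1
  have hσP : σ * P = σ := by
    have h0 : cfc (fun x : ℝ => x) σ = σ := cfc_id' ℝ σ
    calc σ * P = cfc (fun x : ℝ => x) σ * P := by rw [h0]
      _ = cfc (fun x : ℝ => x * if x = 0 then 0 else 1) σ := cfc_mul_cfc hσ.1 _ _
      _ = cfc (fun x : ℝ => x) σ := cfc_congr fun x _ => by
        by_cases hx : x = 0 <;> simp [hx]
      _ = σ := h0
  have hPh : Pᴴ = P := (cfc_posSemidef (A := σ) fun x _ => by split_ifs <;> norm_num).1.eq
  have hρP : ρ * (1 - P) = 0 := by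
    have h0 : σ * (1 - P) = 0 := by rw [mul_sub, mul_one, hσP, sub_self]
    ext i j
    have h1 : σ *ᵥ (fun k => (1 - P) k j) = 0 := by
      ext k
      exact congrFun (congrFun h0 k) j
    exact congrFun (supp_le_supp_iff.1 hs _ h1) i
  set r := matPow ρ (1 / 2) with hr
  have hrh : rᴴ = r := (matPow_posSemidef hρ _).1.eq
  have hrr : r * r = ρ := by
    rw [hr, matPow_mul_matPow hρ (by norm_num)]
    norm_num
    exact matPow_one hρ.1
  have hrP0 : r * (1 - P) = 0 := by
    rw [← conjTranspose_mul_self_eq_zero, conjTranspose_mul, hrh]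
    calc _ = (1 - P)ᴴ * (r * r * (1 - P)) := by simp only [mul_assoc]
      _ = 0 := by rw [hrr, hρP, mul_zero]
  have hrP : r * P = r := by
    rw [mul_sub, mul_one, sub_eq_zero] at hrP0
    exact hrP0.symm
  have hPr : P * r = r := by
    have := congrArg conjTranspose hrP
    rwa [conjTranspose_mul, hPh, hrh] at this
  -- Both sides are functions of σ, so this is the scalar inequality ((1-δ)x + e)^(-t) ≤
  -- ((1-δ)x)^(-t) for x > 0.
  have hle : ((((1 - δ) ^ (-t) : ℝ) : ℂ) • matPow σ (-t) - P * matPow τ (-t) * P).PosSemidef := by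
    have e1 : P * matPow τ (-t) * P = cfc (fun x : ℝ => if x = 0 then 0 else
        ((1 - δ) * x + e) ^ (-t)) σ := by
      rw [hτt, hP, cfc_mul_cfc hσ.1, cfc_mul_cfc hσ.1]
      exact cfc_congr fun x _ => by
        by_cases hx : x = 0 <;> simp [hx]
    have e2 : (((1 - δ) ^ (-t) : ℝ) : ℂ) • matPow σ (-t) =
        cfc (fun x : ℝ => (1 - δ) ^ (-t) * x ^ (-t)) σ := by
      rw [Complex.coe_smul, matPow]
      have hfin := (Matrix.finite_real_spectrum (A := σ))
      exact (cfc_smul ((1 - δ) ^ (-t)) (fun x : ℝ => x ^ (-t)) σ (hfin.continuousOn _)).symm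
    rw [e1, e2]
    refine cfc_posSemidef_sub hσ.1 fun x hx => ?_
    have hx0 := spectrum_nonneg hσ hx
    have ht0 : -t ≤ 0 := neg_nonpos.2 (div_nonneg (by linarith) hα0.le)
    split_ifs with h0
    · exact mul_nonneg (Real.rpow_nonneg h1δ.le _) (Real.rpow_nonneg hx0 _)
    · have hxp : 0 < x := lt_of_le_of_ne hx0 (Ne.symm h0)
      rw [← Real.mul_rpow h1δ.le hx0]
      exact Real.rpow_le_rpow_of_nonpos (by positivity) (by linarith) ht0
  have hc0 : 0 ≤ (1 - δ) ^ (-t) := Real.rpow_nonneg h1δ.le _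
  have hmain := hle.mul_mul_conjTranspose_same r
  rw [hrh, mul_sub, sub_mul, Matrix.mul_smul, Matrix.smul_mul] at hmain
  have e3 : r * (P * matPow τ (-t) * P) * r = r * matPow τ (-t) * r := by
    calc _ = (r * P) * matPow τ (-t) * (P * r) := by simp only [mul_assoc]
      _ = _ := by rw [hrP, hPr]
  rw [e3] at hmain
  have hA := matPow_sandwich_posSemidef hρ hσ (1 / 2) (-t)
  have h := trPow_mono (hA.smul (show (0 : ℂ) ≤ ((1 - δ) ^ (-t) : ℝ) by exact_mod_cast hc0))
    (matPow_sandwich_posSemidef hρ hτp (1 / 2) (-t)) hmain hα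
  rw [trPow_smul hA hc0, ← Real.rpow_mul h1δ.le] at h
  rw [quasi_eq hρ hτp hα, quasi_eq hρ hσ hα]
  have e4 : -t * α = 1 - α := by rw [ht]; field_simp; ring
  rwa [e4] at h

/-- A bound uniform in ρ, from which the Holevo information is seen to be finite. -/
theorem quasi_maxMixed_le [Nonempty n] {ρ : Matrix n n ℂ} (hρ : IsDensity ρ) {α : ℝ} (hα : 1 < α) :
    quasi α ρ (maxMixed n) ≤ ((((Fintype.card n : ℝ)⁻¹) ^ (-((α - 1) / α))) ^ α) := by
  have hd : 0 ≤ (Fintype.card n : ℝ)⁻¹ := by positivity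
  have e1 : matPow (maxMixed n) (-((α - 1) / α)) =
      ((((Fintype.card n : ℝ)⁻¹) ^ (-((α - 1) / α)) : ℝ) : ℂ) • 1 := by
    have h1 : matPow (1 : Matrix n n ℂ) (-((α - 1) / α)) = 1 := by
      have := cfc_diagonal (fun _ : n => (1 : ℝ)) (fun t => t ^ (-((α - 1) / α)))
      simpa only [matPow, Complex.ofReal_one, diagonal_one, Real.one_rpow] using this
    rw [maxMixed, ← Complex.coe_smul, matPow_smul PosSemidef.one hd, h1]
  have e2 : matPow ρ (1 / 2) * matPow ρ (1 / 2) = ρ := by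
    rw [matPow_mul_matPow hρ.1 (by norm_num)]
    norm_num
    exact matPow_one hρ.1.1
  rw [quasi_eq hρ.1 maxMixed_posDef.posSemidef hα, e1, Matrix.mul_smul, Matrix.smul_mul, mul_one,
    e2, trPow_smul hρ.1 (Real.rpow_nonneg hd _)]
  exact mul_le_of_le_one_right (Real.rpow_nonneg (Real.rpow_nonneg hd _) _) (trPow_le_one hρ hα)

end Regularization

/-! ### One reference state for all channel inputs -/

section ChannelMinimax

variable {A B : Type*} [Fintype A] [DecidableEq A] [Fintype B] [DecidableEq B]

/-- A reference state that is good on average for each ensemble yields one that is almost as good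
for all input states simultaneously. -/
theorem exists_posDef_forall_quasi_le [Nonempty B] {Φ : Matrix A A ℂ →ₗ[ℂ] Matrix B B ℂ}
    (hΦ : ∀ ρ, IsDensity ρ → IsDensity (Φ ρ)) {α q δ : ℝ} (hα : 1 < α) (hδ0 : 0 < δ) (hδ1 : δ < 1)
    (hq : ∀ E : Ensemble A, ∃ σ : Matrix B B ℂ, IsDensity σ ∧
      (∀ x, 0 < E.prob x → supp (Φ (E.state x)) ≤ supp σ) ∧
        ∑ x, E.prob x * quasi α (Φ (E.state x)) σ ≤ q) :
    ∃ σ : Matrix B B ℂ, σ.PosDef ∧ IsDensity σ ∧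
      ∀ ρ, IsDensity ρ → quasi α (Φ ρ) σ ≤ (1 - δ) ^ (1 - α) * q := by
  have h1δ : 0 < 1 - δ := by linarith
  -- This affine map sends all densities into the positive definite ones, where the quasi-entropy is
  -- known to be continuous and convex. The factor (1-δ)^(1-α) is the price.
  let mix : Matrix B B ℂ → Matrix B B ℂ := fun σ => (1 - δ) • σ + δ • maxMixed B
  have hmix : ∀ σ, IsDensity σ → (mix σ).PosDef := fun σ hσ =>
    Matrix.PosDef.posSemidef_add (hσ.1.smul h1δ.le) (maxMixed_posDef.smul hδ0)
  have hmixd : ∀ σ, IsDensity σ → IsDensity (mix σ) := fun σ hσ =>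
    convex_setOf_isDensity hσ maxMixed_isDensity h1δ.le hδ0.le (by ring)
  have hmixa : ∀ (σ τ : Matrix B B ℂ) (a b : ℝ), a + b = 1 →
      mix (a • σ + b • τ) = a • mix σ + b • mix τ := by
    intro σ τ a b hab
    obtain rfl : b = 1 - a := by linarith
    simp only [mix]
    module
  suffices h : ∃ σ ∈ {σ : Matrix B B ℂ | IsDensity σ}, ∀ ρ : {ρ : Matrix A A ℂ // IsDensity ρ},
      quasi α (Φ ρ.1) (mix σ) ≤ (1 - δ) ^ (1 - α) * q by
    obtain ⟨σ, hσ, h⟩ := h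
    exact ⟨mix σ, hmix σ hσ, hmixd σ hσ, fun ρ hρ => h ⟨ρ, hρ⟩⟩
  refine exists_forall_le_of_convex_combinations
    (I := {ρ : Matrix A A ℂ // IsDensity ρ}) (X := {σ : Matrix B B ℂ | IsDensity σ})
    (h := fun ρ σ => quasi α (Φ ρ.1) (mix σ)) (c := (1 - δ) ^ (1 - α) * q)
    isCompact_setOf_isDensity isClosed_setOf_isDensity convex_setOf_isDensity
    ⟨_, maxMixed_isDensity⟩ (fun ρ => ?_) (fun ρ => ?_) ?_
  · exact (quasi_continuousOn (hΦ _ ρ.2).1 hα).comp (by fun_prop) hmix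
  · refine ⟨convex_setOf_isDensity, fun σ hσ τ hτ a b ha hb hab => ?_⟩
    have hd := hmixd _ (convex_setOf_isDensity hσ hτ ha hb hab)
    simp only [hmixa _ _ _ _ hab] at hd ⊢
    exact quasi_convex (hΦ _ ρ.2).1 (hmix σ hσ) (hmix τ hτ) hα ha hb hab hd.1
  · intro t p hp0 hp1
    let e := t.equivFin
    let E : Ensemble A :=
      { size := t.card
        prob := fun x => p (e.symm x)
        state := fun x => (e.symm x).1.1
        prob_nonneg := fun x => hp0 _
        prob_sum := by rw [← hp1]; exact Equiv.sum_comp e.symm p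
        isDensity := fun x => (e.symm x).1.2 }
    obtain ⟨σ, hσ, hs, hle⟩ := hq E
    refine ⟨σ, hσ, ?_⟩
    have e1 : ∑ i, p i * quasi α (Φ i.1.1) (mix σ) =
        ∑ x, E.prob x * quasi α (Φ (E.state x)) (mix σ) :=
      (Equiv.sum_comp e.symm fun i => p i * quasi α (Φ i.1.1) (mix σ)).symm
    rw [e1]
    calc _ ≤ ∑ x, (1 - δ) ^ (1 - α) * (E.prob x * quasi α (Φ (E.state x)) σ) := by
          refine Finset.sum_le_sum fun x _ => ?_
          rcases (E.prob_nonneg x).eq_or_lt with h0 | h0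
          · rw [← h0]; simp
          · have := quasi_mix_le (hΦ _ (E.isDensity x)).1 hσ.1 (hs x h0) hα hδ0 hδ1
            calc _ ≤ E.prob x * _ := mul_le_mul_of_nonneg_left this h0.le
              _ = _ := by ring
      _ ≤ _ := by
        rw [← Finset.mul_sum]
        exact mul_le_mul_of_nonneg_left hle (Real.rpow_nonneg h1δ.le _)

end ChannelMinimax

/-! ### Classical-quantum states as block diagonal matrices -/

section ClassicalQuantum

variable {B : Type*} [Fintype B] [DecidableEq B] {m : ℕ}

/-- Block diagonal matrices, with the block index in front. -/
def blockDiag (m : ℕ) (B : Type*) [Fintype B] [DecidableEq B] :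
    (Fin m → Matrix B B ℂ) →ₐ[ℝ] Matrix (Fin m × B) (Fin m × B) ℂ :=
  (reindexAlgEquiv ℝ ℂ (Equiv.prodComm B (Fin m))).toAlgHom.comp
    { blockDiagonalRingHom B (Fin m) ℂ with
      commutes' := fun r => by
        ext ⟨b, x⟩ ⟨c, y⟩
        simp [blockDiagonal_apply, algebraMap_matrix_apply, Pi.algebraMap_apply, Prod.ext_iff]
        split_ifs <;> simp_all }

theorem blockDiag_apply (C : Fin m → Matrix B B ℂ) (i j : Fin m × B) :
    blockDiag m B C i j = if i.1 = j.1 then C i.1 i.2 j.2 else 0 := by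
  rfl

theorem trace_blockDiag (C : Fin m → Matrix B B ℂ) :
    (blockDiag m B C).trace = ∑ x, (C x).trace := by
  simp [Matrix.trace, Fintype.sum_prod_type, blockDiag_apply]

theorem isHermitian_blockDiag {C : Fin m → Matrix B B ℂ} (hC : ∀ x, (C x).IsHermitian) :
    (blockDiag m B C).IsHermitian := by
  ext i j
  rw [conjTranspose_apply, blockDiag_apply, blockDiag_apply]
  by_cases h : i.1 = j.1
  · rw [if_pos h.symm, if_pos h, h]
    exact (hC j.1).apply _ _
  · rw [if_neg (Ne.symm h), if_neg h, star_zero]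

theorem matPow_blockDiag {C : Fin m → Matrix B B ℂ} (hC : ∀ x, (C x).IsHermitian) (s : ℝ) :
    matPow (blockDiag m B C) s = blockDiag m B fun x => matPow (C x) s :=
  cfc_map_pi_algHom (blockDiag m B) hC (isHermitian_blockDiag hC) _

theorem blockDiag_mulVec (C : Fin m → Matrix B B ℂ) (v : Fin m × B → ℂ) (x : Fin m) (b : B) :
    (blockDiag m B C *ᵥ v) (x, b) = (C x *ᵥ fun c => v (x, c)) b := by
  simp [mulVec, dotProduct, Fintype.sum_prod_type, blockDiag_apply, Finset.sum_ite_eq, ite_mul]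

theorem cqState_eq (p : Fin m → ℝ) (ρ : Fin m → Matrix B B ℂ) :
    cqState p ρ = blockDiag m B fun x => (p x : ℂ) • ρ x := by
  ext ⟨x, b⟩ ⟨y, c⟩
  rw [cqState, blockDiag_apply, Matrix.sum_apply]
  simp only [Matrix.smul_apply, kroneckerMap_apply, smul_eq_mul, single_apply]
  rw [Finset.sum_eq_single x]
  · by_cases h : x = y <;> simp [h]
  · intro z _ hz
    simp [hz]
  · simp

theorem classicalState_kronecker (p : Fin m → ℝ) (σ : Matrix B B ℂ) :
    classicalState p ⊗ₖ σ = blockDiag m B fun x => (p x : ℂ) • σ := by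
  ext ⟨x, b⟩ ⟨y, c⟩
  rw [classicalState, blockDiag_apply, kroneckerMap_apply, diagonal_apply]
  by_cases h : x = y <;> simp [h]

/-- Block x carries the scalar p^s p p^s = p^(1/α) for p > 0, whose α-th power is p; a block of
weight 0 contributes 0. This makes the quasi-entropy an average and is why ensembles enter as convex
combinations. -/
theorem trPow_cq {p : Fin m → ℝ} (hp : ∀ x, 0 ≤ p x) {ρ : Fin m → Matrix B B ℂ}
    (hρ : ∀ x, (ρ x).PosSemidef) {σ : Matrix B B ℂ} (hσ : σ.PosSemidef) {α : ℝ} (hα : 1 < α) :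
    trPow (matPow (classicalState p ⊗ₖ σ) ((1 - α) / (2 * α)) * cqState p ρ *
      matPow (classicalState p ⊗ₖ σ) ((1 - α) / (2 * α))) α =
      ∑ x, p x * quasi α (ρ x) σ := by
  have hα0 : α ≠ 0 := by linarith
  set s := (1 - α) / (2 * α) with hs
  have hpc : ∀ x, (0 : ℂ) ≤ p x := fun x => by exact_mod_cast hp x
  have hmid : ∀ x, (matPow σ s * ρ x * matPow σ s).PosSemidef := fun x => by
    have := (hρ x).mul_mul_conjTranspose_same (matPow σ s)
    rwa [(matPow_posSemidef hσ s).1.eq] at this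
  have hblock : ∀ x, matPow ((p x : ℂ) • σ) s * ((p x : ℂ) • ρ x) * matPow ((p x : ℂ) • σ) s =
      ((p x ^ s * p x * p x ^ s : ℝ) : ℂ) • (matPow σ s * ρ x * matPow σ s) := by
    intro x
    rw [matPow_smul hσ (hp x)]
    simp only [Matrix.smul_mul, Matrix.mul_smul, smul_smul]
    congr 1
    push_cast
    ring
  have hnn : ∀ x, 0 ≤ p x ^ s * p x * p x ^ s := fun x =>
    mul_nonneg (mul_nonneg (Real.rpow_nonneg (hp x) s) (hp x)) (Real.rpow_nonneg (hp x) s)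
  have hpow : ∀ x, (p x ^ s * p x * p x ^ s) ^ α = p x := by
    intro x
    rcases (hp x).eq_or_lt with h0 | h0
    · rw [← h0]; simp [Real.zero_rpow hα0]
    · have e : p x ^ s * p x * p x ^ s = p x ^ (1 / α) := by
        conv_lhs => rw [← Real.rpow_one (p x)]
        simp only [← Real.rpow_mul h0.le, one_mul]
        rw [← Real.rpow_add h0, ← Real.rpow_add h0]
        congr 1
        rw [hs]; field_simp; ring
      rw [e, ← Real.rpow_mul h0.le, one_div_mul_cancel hα0, Real.rpow_one]
  have hH : ∀ x, (matPow ((p x : ℂ) • σ) s * ((p x : ℂ) • ρ x) *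
      matPow ((p x : ℂ) • σ) s).IsHermitian := fun x => by
    rw [hblock]
    exact ((hmid x).smul (show (0 : ℂ) ≤ _ by exact_mod_cast hnn x)).1
  rw [cqState_eq, classicalState_kronecker, matPow_blockDiag fun x => (hσ.smul (hpc x)).1,
    ← map_mul, ← map_mul, trPow]
  change (matPow (blockDiag m B fun x => matPow ((p x : ℂ) • σ) s * ((p x : ℂ) • ρ x) *
    matPow ((p x : ℂ) • σ) s) α).trace.re = _
  rw [matPow_blockDiag hH, trace_blockDiag, Complex.re_sum]
  refine Finset.sum_congr rfl fun x _ => ?_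
  rw [hblock]
  change trPow _ α = _
  rw [trPow_smul (hmid x) (hnn x), hpow, quasi]

/-- Blocks of weight 0 vanish on both sides and impose no condition. -/
theorem supp_cq_le_iff {p : Fin m → ℝ} (hp : ∀ x, 0 ≤ p x) {ρ : Fin m → Matrix B B ℂ}
    {σ : Matrix B B ℂ} :
    supp (cqState p ρ) ≤ supp (classicalState p ⊗ₖ σ) ↔
      ∀ x, 0 < p x → supp (ρ x) ≤ supp σ := by
  rw [cqState_eq, classicalState_kronecker]
  simp only [supp_le_supp_iff]
  constructor
  · intro h x hx v hv
    have h1 := h (fun i => if i.1 = x then v i.2 else 0) (by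
      ext ⟨y, b⟩
      rw [blockDiag_mulVec]
      by_cases hy : y = x
      · simp only [hy, if_true]
        rw [smul_mulVec, hv]; simp
      · simp only [hy, if_false]
        exact congrFun (mulVec_zero _) b)
    ext b
    have h2 := congrFun h1 (x, b)
    rw [blockDiag_mulVec] at h2
    simp only [if_true] at h2
    rw [smul_mulVec] at h2
    have hx' : (p x : ℂ) ≠ 0 := by exact_mod_cast hx.ne'
    exact (mul_eq_zero.1 h2).resolve_left hx'
  · intro h v hv
    ext ⟨x, b⟩
    rw [blockDiag_mulVec, smul_mulVec]
    rcases (hp x).eq_or_lt with h0 | h0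
    · simp [← h0]
    · have h1 : σ *ᵥ (fun c => v (x, c)) = 0 := by
        ext c
        have h2 := congrFun hv (x, c)
        rw [blockDiag_mulVec, smul_mulVec] at h2
        have hx' : (p x : ℂ) ≠ 0 := by exact_mod_cast h0.ne'
        exact (mul_eq_zero.1 h2).resolve_left hx'
      rw [h x h0 _ h1]; simp

theorem sandwichedQuasiEntropy_cq {p : Fin m → ℝ} (hp : ∀ x, 0 ≤ p x) {ρ : Fin m → Matrix B B ℂ}
    (hρ : ∀ x, (ρ x).PosSemidef) {σ : Matrix B B ℂ} (hσ : σ.PosSemidef) {α : ℝ} (hα : 1 < α)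
    (hs : ∀ x, 0 < p x → supp (ρ x) ≤ supp σ) :
    sandwichedQuasiEntropy α (cqState p ρ) (classicalState p ⊗ₖ σ) =
      ENNReal.ofReal (∑ x, p x * quasi α (ρ x) σ) := by
  rw [sandwichedQuasiEntropy, if_pos ((supp_cq_le_iff hp).2 hs), ← trPow_cq hp hρ hσ hα, trPow]

theorem supp_le_of_sandwichedQuasiEntropy_ne_top {p : Fin m → ℝ} (hp : ∀ x, 0 ≤ p x)
    {ρ : Fin m → Matrix B B ℂ} {σ : Matrix B B ℂ} {α : ℝ}
    (h : sandwichedQuasiEntropy α (cqState p ρ) (classicalState p ⊗ₖ σ) ≠ ⊤) :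
    ∀ x, 0 < p x → supp (ρ x) ≤ supp σ := by
  rw [sandwichedQuasiEntropy] at h
  split_ifs at h with hs
  · exact (supp_cq_le_iff hp).1 hs
  · exact absurd rfl h

theorem supp_le_of_posDef {A σ : Matrix B B ℂ} (hσ : σ.PosDef) : supp A ≤ supp σ :=
  supp_le_supp_iff.2 fun v hv => by rw [PosDef.mulVec_eq_zero hσ hv, mulVec_zero]

end ClassicalQuantum

/-! ### Entanglement-breaking channels and product reference states -/

section EntanglementBreaking

variable {A₁ B₁ A₂ B₂ : Type*} [Fintype A₁] [DecidableEq A₁] [Fintype B₁] [DecidableEq B₁]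
  [Fintype A₂] [DecidableEq A₂] [Fintype B₂] [DecidableEq B₂]

/-- The unnormalised post-measurement state `Tr₁ ((M ⊗ 1) ρ)`. -/
def condState (M : Matrix A₁ A₁ ℂ) :
    Matrix (A₁ × A₂) (A₁ × A₂) ℂ →ₗ[ℂ] Matrix A₂ A₂ ℂ where
  toFun ρ := Matrix.of fun c d => ∑ a, ∑ a', M a a' * ρ (a', c) (a, d)
  map_add' ρ ρ' := by
    ext c d
    simp [mul_add, Finset.sum_add_distrib]
  map_smul' r ρ := by
    ext c d
    simp only [Matrix.smul_apply, of_apply, smul_eq_mul, Finset.mul_sum, RingHom.id_apply]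
    exact Finset.sum_congr rfl fun _ _ => Finset.sum_congr rfl fun _ _ => by ring

theorem condState_apply (M : Matrix A₁ A₁ ℂ) (ρ : Matrix (A₁ × A₂) (A₁ × A₂) ℂ) (c d : A₂) :
    condState M ρ c d = ∑ a, ∑ a', M a a' * ρ (a', c) (a, d) := rfl

theorem condState_kronecker (M X : Matrix A₁ A₁ ℂ) (Y : Matrix A₂ A₂ ℂ) :
    condState M (X ⊗ₖ Y) = (M * X).trace • Y := by
  ext c d
  simp only [condState_apply, kroneckerMap_apply, Matrix.smul_apply, smul_eq_mul, Matrix.trace,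
    diag_apply, Matrix.mul_apply, Finset.sum_mul]
  exact Finset.sum_congr rfl fun _ _ => Finset.sum_congr rfl fun _ _ => by ring

theorem condState_posSemidef {M : Matrix A₁ A₁ ℂ} (hM : M.PosSemidef)
    {ρ : Matrix (A₁ × A₂) (A₁ × A₂) ℂ} (hρ : ρ.PosSemidef) : (condState M ρ).PosSemidef := by
  obtain ⟨L, rfl⟩ := CStarAlgebra.nonneg_iff_eq_star_mul_self.1 hM.nonneg
  -- Kraus operators of the conditioning map: with M = L†L, the operator `W r` is the r-th row of L
  -- tensored with the identity of the second system.
  let W : A₁ → Matrix A₂ (A₁ × A₂) ℂ := fun r => Matrix.of fun c i => if c = i.2 then L r i.1 else 0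
  have e : condState (star L * L) ρ = ∑ r, W r * ρ * (W r)ᴴ := by
    ext c d
    rw [condState_apply, Matrix.sum_apply]
    have h1 : ∀ r, (W r * ρ * (W r)ᴴ) c d =
        ∑ a, ∑ a', star (L r a) * L r a' * ρ (a', c) (a, d) := by
      intro r
      rw [Matrix.mul_apply, Fintype.sum_prod_type]
      refine Finset.sum_congr rfl fun a _ => ?_
      rw [Finset.sum_eq_single d]
      · rw [Matrix.mul_apply, Fintype.sum_prod_type, Finset.sum_mul]
        refine Finset.sum_congr rfl fun a' _ => ?_
        rw [Finset.sum_eq_single c]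
        · simp [W, conjTranspose_apply]; ring
        · intro b _ hb
          simp [W, Ne.symm hb]
        · simp
      · intro b _ hb
        simp [W, conjTranspose_apply, Ne.symm hb]
      · simp
    simp only [h1]
    symm
    rw [Finset.sum_comm]
    refine Finset.sum_congr rfl fun a _ => ?_
    rw [Finset.sum_comm]
    refine Finset.sum_congr rfl fun a' _ => ?_
    rw [Matrix.mul_apply, Finset.sum_mul]
    rfl
  rw [e]
  exact posSemidef_sum _ fun r _ => hρ.mul_mul_conjTranspose_same (W r)

/-- The marginal on the first factor. -/
def marginal (ρ : Matrix (A₁ × A₂) (A₁ × A₂) ℂ) : Matrix A₁ A₁ ℂ :=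
  ∑ c, ρ.submatrix (fun a => (a, c)) (fun a => (a, c))

theorem marginal_isDensity {ρ : Matrix (A₁ × A₂) (A₁ × A₂) ℂ} (hρ : IsDensity ρ) :
    IsDensity (marginal ρ) := by
  refine ⟨posSemidef_sum _ fun c _ => hρ.1.submatrix _, ?_⟩
  rw [← hρ.2, marginal, trace_sum, Matrix.trace, Fintype.sum_prod_type, Finset.sum_comm]
  rfl

theorem trace_condState (M : Matrix A₁ A₁ ℂ) (ρ : Matrix (A₁ × A₂) (A₁ × A₂) ℂ) :
    (condState M ρ).trace = (M * marginal ρ).trace := by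
  simp only [Matrix.trace, diag_apply, condState_apply, marginal, Matrix.mul_apply,
    Matrix.sum_apply, submatrix_apply, Finset.mul_sum]
  rw [Finset.sum_comm]

/-- Both sides are linear in ρ, so elementary tensors suffice. Entangled inputs thus yield separable
outputs, the only use of the entanglement-breaking form. -/
theorem tensorMap_eq_sum {k : ℕ} {Φ : Matrix A₁ A₁ ℂ →ₗ[ℂ] Matrix B₁ B₁ ℂ}
    {M : Fin k → Matrix A₁ A₁ ℂ} {N : Fin k → Matrix B₁ B₁ ℂ}
    (hΦ : ∀ X, Φ X = ∑ x, (M x * X).trace • N x) (Ψ : Matrix A₂ A₂ ℂ →ₗ[ℂ] Matrix B₂ B₂ ℂ)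
    (ρ : Matrix (A₁ × A₂) (A₁ × A₂) ℂ) :
    tensorMap Φ Ψ ρ = ∑ x, N x ⊗ₖ Ψ (condState (M x) ρ) := by
  obtain ⟨t, rfl⟩ := (kroneckerLinearEquiv A₁ A₁ A₂ A₂ ℂ).surjective ρ
  induction t using TensorProduct.induction_on with
  | zero => simp
  | add t t' ht ht' =>
    simp only [map_add, ht, ht', kronecker_add, Finset.sum_add_distrib]
  | tmul X Y =>
    rw [kroneckerLinearEquiv_tmul, tensorMap_kronecker, hΦ, sum_kronecker]
    refine Finset.sum_congr rfl fun x _ => ?_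
    rw [condState_kronecker, map_smul, kronecker_smul, smul_kronecker]

/-- The α-homogeneity of the quasi-entropy bounds the second factor of outcome x by r g_x^α. The
multiplicativity bound replaces these factors by the weights g_x, and the resulting sum is the image
of the first marginal of ρ, to which the bound q applies. -/
theorem quasi_tensorMap_le {Φ : Matrix A₁ A₁ ℂ →ₗ[ℂ] Matrix B₁ B₁ ℂ}
    (hΦ : IsEntanglementBreaking Φ) {Ψ : Matrix A₂ A₂ ℂ →ₗ[ℂ] Matrix B₂ B₂ ℂ}
    (hΨ : ∀ X, X.PosSemidef → (Ψ X).PosSemidef) {σ : Matrix B₁ B₁ ℂ} {τ : Matrix B₂ B₂ ℂ}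
    (hσ : σ.PosSemidef) (hτ : τ.PosSemidef) {α q r : ℝ} (hα : 1 < α) (hr : 0 ≤ r)
    (hq : ∀ ρ, IsDensity ρ → quasi α (Φ ρ) σ ≤ q) (hr' : ∀ ρ, IsDensity ρ → quasi α (Ψ ρ) τ ≤ r)
    {ρ : Matrix (A₁ × A₂) (A₁ × A₂) ℂ} (hρ : IsDensity ρ) :
    quasi α (tensorMap Φ Ψ ρ) (σ ⊗ₖ τ) ≤ q * r := by
  obtain ⟨k, M, N, hM, hN, hMN⟩ := hΦ
  have hα0 : α ≠ 0 := by linarith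
  set s := (1 - α) / (2 * α) with hs
  set g : Fin k → ℝ := fun x => (condState (M x) ρ).trace.re with hg
  have hG : ∀ x, (condState (M x) ρ).PosSemidef := fun x => condState_posSemidef (hM x) hρ.1
  have hg0 : ∀ x, 0 ≤ g x := fun x => (Complex.le_def.1 (hG x).trace_nonneg).1
  have hgc : ∀ x, (condState (M x) ρ).trace = (g x : ℂ) := fun x =>
    Complex.ext rfl (Complex.le_def.1 (hG x).trace_nonneg).2.symm
  have hsσ := matPow_posSemidef hσ s
  have hsτ := matPow_posSemidef hτ s
  have hN' : ∀ x, (matPow σ s * N x * matPow σ s).PosSemidef := fun x => by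
    have := (hN x).mul_mul_conjTranspose_same (matPow σ s)
    rwa [hsσ.1.eq] at this
  have hR : ∀ x, (matPow τ s * Ψ (condState (M x) ρ) * matPow τ s).PosSemidef := fun x => by
    have := (hΨ _ (hG x)).mul_mul_conjTranspose_same (matPow τ s)
    rwa [hsτ.1.eq] at this
  have hbound : ∀ x, trPow (matPow τ s * Ψ (condState (M x) ρ) * matPow τ s) α ≤ r * g x ^ α := by
    intro x
    change quasi α (Ψ (condState (M x) ρ)) τ ≤ _
    rcases (hg0 x).eq_or_lt with h0 | h0
    · have hz : condState (M x) ρ = 0 := (hG x).trace_eq_zero_iff.1 (by rw [hgc, ← h0]; simp)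
      rw [hz, map_zero, ← h0, Real.zero_rpow hα0, mul_zero, quasi, mul_zero, zero_mul,
        trPow_zero hα0]
    · have hgx : (g x : ℂ) ≠ 0 := by exact_mod_cast h0.ne'
      have hd : IsDensity (((g x)⁻¹ : ℂ) • condState (M x) ρ) := by
        refine ⟨(hG x).smul (by rw [← Complex.ofReal_inv]; exact_mod_cast (inv_pos.2 h0).le), ?_⟩
        rw [trace_smul, hgc, smul_eq_mul, inv_mul_cancel₀ hgx]
      have e : condState (M x) ρ = (g x : ℂ) • (((g x)⁻¹ : ℂ) • condState (M x) ρ) := by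
        rw [smul_smul, mul_inv_cancel₀ hgx, one_smul]
      rw [e, map_smul, quasi_smul (hΨ _ hd.1) hτ h0.le, mul_comm]
      exact mul_le_mul_of_nonneg_right (hr' _ hd) (Real.rpow_nonneg h0.le _)
  have key := trPow_sum_kronecker_le hN' hR hg0 hα hr hbound
  have e1 : ∑ x, (g x : ℂ) • (matPow σ s * N x * matPow σ s) =
      matPow σ s * Φ (marginal ρ) * matPow σ s := by
    rw [hMN, Finset.mul_sum, Finset.sum_mul]
    refine Finset.sum_congr rfl fun x _ => ?_
    rw [← trace_condState, hgc, Matrix.mul_smul, Matrix.smul_mul]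
  have e2 : matPow (σ ⊗ₖ τ) s * tensorMap Φ Ψ ρ * matPow (σ ⊗ₖ τ) s =
      ∑ x, (matPow σ s * N x * matPow σ s) ⊗ₖ
        (matPow τ s * Ψ (condState (M x) ρ) * matPow τ s) := by
    rw [matPow_kronecker hσ hτ, tensorMap_eq_sum hMN, Finset.mul_sum, Finset.sum_mul]
    refine Finset.sum_congr rfl fun x _ => ?_
    rw [← mul_kronecker_mul, ← mul_kronecker_mul]
  rw [e1] at key
  rw [quasi, ← hs, e2, mul_comm q]
  exact key.trans (mul_le_mul_of_nonneg_left (hq _ (marginal_isDensity hρ)) hr)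

theorem IsEntanglementBreakingChannel.isDensity {Φ : Matrix A₁ A₁ ℂ →ₗ[ℂ] Matrix B₁ B₁ ℂ}
    (hΦ : IsEntanglementBreakingChannel Φ) {ρ : Matrix A₁ A₁ ℂ} (hρ : IsDensity ρ) :
    IsDensity (Φ ρ) := by
  refine ⟨?_, (hΦ.2 ρ).trans hρ.2⟩
  obtain ⟨k, M, N, hM, hN, hMN⟩ := hΦ.1
  rw [hMN]
  exact posSemidef_sum _ fun x _ => (hN x).smul (trace_mul_nonneg (hM x) hρ.1)

theorem IsCompletelyPositive.posSemidef {Ψ : Matrix A₂ A₂ ℂ →ₗ[ℂ] Matrix B₂ B₂ ℂ}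
    (hΨ : IsCompletelyPositive Ψ) {X : Matrix A₂ A₂ ℂ} (hX : X.PosSemidef) :
    (Ψ X).PosSemidef := by
  -- A one-dimensional reference system.
  have h := hΨ 1 ((1 : Matrix (Fin 1) (Fin 1) ℂ) ⊗ₖ X) (PosSemidef.one.kronecker hX)
  rw [tensorMap_kronecker] at h
  have h' := h.submatrix fun b : B₂ => ((0 : Fin 1), b)
  convert h' using 1
  ext b c
  simp

theorem IsChannel.isDensity {Ψ : Matrix A₂ A₂ ℂ →ₗ[ℂ] Matrix B₂ B₂ ℂ} (hΨ : IsChannel Ψ)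
    {ρ : Matrix A₂ A₂ ℂ} (hρ : IsDensity ρ) : IsDensity (Ψ ρ) :=
  ⟨hΨ.1.posSemidef hρ.1, (hΨ.2 ρ).trans hρ.2⟩

end EntanglementBreaking

/-! ### Passing between bounds on divergences and on quasi-entropies -/

section Logarithm

variable {n : Type*} [Fintype n] [DecidableEq n]

theorem renyi_log_mono {α : ℝ} (hα : 1 < α) :
    Monotone fun x : ENNReal => ((1 / (α - 1) : ℝ) : EReal) * log₂ x := by
  intro x y hxy
  have h1 : (0 : EReal) ≤ ((1 / (α - 1) : ℝ) : EReal) := by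
    have : (0 : ℝ) ≤ 1 / (α - 1) := by
      have : 0 < α - 1 := by linarith
      positivity
    exact_mod_cast this
  have h2 : (0 : EReal) ≤ ((Real.log 2 : ℝ) : EReal) := by
    exact_mod_cast Real.log_nonneg one_le_two
  exact mul_le_mul_of_nonneg_left
    (EReal.div_le_div_right_of_nonneg h2 (ENNReal.log_monotone hxy)) h1

theorem renyi_log_two_rpow {α : ℝ} (hα : 1 < α) (c : ℝ) :
    ((1 / (α - 1) : ℝ) : EReal) * log₂ (ENNReal.ofReal (2 ^ ((α - 1) * c))) = c := by
  have h1 : α - 1 ≠ 0 := by linarith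
  have h2 : Real.log 2 ≠ 0 := (Real.log_pos one_lt_two).ne'
  rw [log₂, ENNReal.log_ofReal_of_pos (by positivity), Real.log_rpow two_pos, ← EReal.coe_div,
    ← EReal.coe_mul]
  congr 1
  field_simp

theorem sandwichedRelEntropy_le {α : ℝ} (hα : 1 < α) {A B : Matrix n n ℂ} {c : ℝ}
    (h : sandwichedQuasiEntropy α A B ≤ ENNReal.ofReal (2 ^ ((α - 1) * c))) :
    sandwichedRelEntropy α A B ≤ c :=
  (renyi_log_mono hα h).trans_eq (renyi_log_two_rpow hα c)

theorem sandwichedQuasiEntropy_lt {α : ℝ} (hα : 1 < α) {A B : Matrix n n ℂ} {c : ℝ}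
    (h : sandwichedRelEntropy α A B < c) :
    sandwichedQuasiEntropy α A B < ENNReal.ofReal (2 ^ ((α - 1) * c)) := by
  by_contra hn
  exact absurd ((renyi_log_two_rpow hα c).symm.trans_le (renyi_log_mono hα (not_lt.1 hn))) (not_le.2 h)

end Logarithm

/-! ### Holevo information as an information radius -/

section Holevo

variable {A B : Type*} [Fintype A] [DecidableEq A] [Fintype B] [DecidableEq B]

theorem alphaHolevo_le {Φ : Matrix A A ℂ →ₗ[ℂ] Matrix B B ℂ}
    (hΦ : ∀ ρ, IsDensity ρ → (Φ ρ).PosSemidef) {α c : ℝ} (hα : 1 < α) {σ : Matrix B B ℂ}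
    (hσ : IsDensity σ) (hσ' : σ.PosDef)
    (h : ∀ ρ, IsDensity ρ → quasi α (Φ ρ) σ ≤ 2 ^ ((α - 1) * c)) : alphaHolevo α Φ ≤ c := by
  refine iSup_le fun E => (iInf_le _ ⟨σ, hσ⟩).trans (sandwichedRelEntropy_le hα ?_)
  rw [sandwichedQuasiEntropy_cq E.prob_nonneg (fun x => hΦ _ (E.isDensity x)) hσ.1 hα
    fun _ _ => supp_le_of_posDef hσ']
  refine ENNReal.ofReal_le_ofReal ?_
  calc _ ≤ ∑ x, E.prob x * 2 ^ ((α - 1) * c) := Finset.sum_le_sum fun x _ =>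
        mul_le_mul_of_nonneg_left (h _ (E.isDensity x)) (E.prob_nonneg x)
    _ = _ := by rw [← Finset.sum_mul, E.prob_sum, one_mul]

theorem exists_density_of_alphaHolevo_lt {Φ : Matrix A A ℂ →ₗ[ℂ] Matrix B B ℂ}
    (hΦ : ∀ ρ, IsDensity ρ → IsDensity (Φ ρ)) {α c : ℝ} (hα : 1 < α) (h : alphaHolevo α Φ < c)
    (E : Ensemble A) :
    ∃ σ : Matrix B B ℂ, IsDensity σ ∧ (∀ x, 0 < E.prob x → supp (Φ (E.state x)) ≤ supp σ) ∧
      ∑ x, E.prob x * quasi α (Φ (E.state x)) σ ≤ 2 ^ ((α - 1) * c) := by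
  have h1 := (le_iSup (fun E : Ensemble A =>
    alphaHolevoEnsemble α E.prob fun x => Φ (E.state x)) E).trans_lt h
  obtain ⟨⟨σ, hσ⟩, h2⟩ := iInf_lt_iff.1 h1
  have h3 := sandwichedQuasiEntropy_lt hα h2
  have hs := supp_le_of_sandwichedQuasiEntropy_ne_top E.prob_nonneg (ne_top_of_lt h3)
  refine ⟨σ, hσ, hs, ?_⟩
  rw [sandwichedQuasiEntropy_cq E.prob_nonneg (fun x => (hΦ _ (E.isDensity x)).1) hσ.1 hα hs] at h3
  exact (ENNReal.ofReal_le_ofReal_iff (by positivity)).1 h3.le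

/-- The `α`-information radius is at most the `α`-Holevo information. -/
theorem exists_posDef_of_alphaHolevo_lt [Nonempty B] {Φ : Matrix A A ℂ →ₗ[ℂ] Matrix B B ℂ}
    (hΦ : ∀ ρ, IsDensity ρ → IsDensity (Φ ρ)) {α c : ℝ} (hα : 1 < α) (h : alphaHolevo α Φ < c) :
    ∃ σ : Matrix B B ℂ, σ.PosDef ∧ IsDensity σ ∧
      ∀ ρ, IsDensity ρ → quasi α (Φ ρ) σ ≤ 2 ^ ((α - 1) * c) := by
  obtain ⟨c', hc', hcc⟩ := EReal.lt_iff_exists_real_btwn.1 h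
  have hcc' : c' < c := by exact_mod_cast hcc
  have hlt : (2 : ℝ) ^ (c' - c) < 1 := Real.rpow_lt_one_of_one_lt_of_neg one_lt_two (by linarith)
  have hpos : (0 : ℝ) < 2 ^ (c' - c) := by positivity
  -- With 1 - δ = 2^(c'-c), the loss (1-δ)^(1-α) is exactly the gap between 2^((α-1)c') and
  -- 2^((α-1)c).
  obtain ⟨σ, hσ, hσd, hσq⟩ := exists_posDef_forall_quasi_le hΦ hα (δ := 1 - 2 ^ (c' - c))
    (by linarith) (by linarith) (exists_density_of_alphaHolevo_lt hΦ hα hc')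
  refine ⟨σ, hσ, hσd, fun ρ hρ => (hσq ρ hρ).trans_eq ?_⟩
  rw [sub_sub_cancel, ← Real.rpow_mul two_pos.le, ← Real.rpow_add two_pos]
  congr 1
  ring

/-- The maximally mixed reference bounds every ensemble. Finiteness is what makes approximating a
sum in `EReal` from above legitimate. -/
theorem alphaHolevo_ne_top [Nonempty B] {Φ : Matrix A A ℂ →ₗ[ℂ] Matrix B B ℂ}
    (hΦ : ∀ ρ, IsDensity ρ → IsDensity (Φ ρ)) {α : ℝ} (hα : 1 < α) : alphaHolevo α Φ ≠ ⊤ := by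
  set K : ℝ := ((Fintype.card B : ℝ)⁻¹ ^ (-((α - 1) / α))) ^ α with hK
  have hK0 : 0 < K := by
    have : (0 : ℝ) < (Fintype.card B : ℝ)⁻¹ := inv_pos.2 (by exact_mod_cast Fintype.card_pos)
    positivity
  have h1 : α - 1 ≠ 0 := by linarith
  have h := alphaHolevo_le (c := Real.logb 2 K / (α - 1)) (fun ρ hρ => (hΦ ρ hρ).1) hα
    maxMixed_isDensity maxMixed_posDef fun ρ hρ => by
      rw [mul_div_cancel₀ _ h1, Real.rpow_logb two_pos (by norm_num) hK0]
      exact quasi_maxMixed_le (hΦ ρ hρ) hα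
  exact ne_top_of_le_ne_top (EReal.coe_ne_top _) h

theorem exists_isDensity_of_ensemble (E : Ensemble A) : ∃ ρ : Matrix A A ℂ, IsDensity ρ := by
  have : Nonempty (Fin E.size) := by
    by_contra h
    rw [not_nonempty_iff] at h
    have := E.prob_sum
    simp at this
  exact ⟨_, E.isDensity (Classical.arbitrary _)⟩

theorem IsDensity.nonempty {ρ : Matrix A A ℂ} (hρ : IsDensity ρ) : Nonempty A := by
  by_contra h
  rw [not_nonempty_iff] at h
  have := hρ.2
  simp [Matrix.trace] at this

end Holevo

end QInfo

end

theorem mainTheorem6 {A₁ B₁ A₂ B₂ : Type*}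
    [Fintype A₁] [DecidableEq A₁] [Fintype B₁] [DecidableEq B₁]
    [Fintype A₂] [DecidableEq A₂] [Fintype B₂] [DecidableEq B₂]
    (NEB : Matrix A₁ A₁ ℂ →ₗ[ℂ] Matrix B₁ B₁ ℂ) (N : Matrix A₂ A₂ ℂ →ₗ[ℂ] Matrix B₂ B₂ ℂ)
    (hNEB : QInfo.IsEntanglementBreakingChannel NEB) (hN : QInfo.IsChannel N)
    (α : ℝ) (h1 : 1 < α) (h2 : α ≤ 2) :
    QInfo.alphaHolevo α (QInfo.tensorMap NEB N) ≤
      QInfo.alphaHolevo α NEB + QInfo.alphaHolevo α N := by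
  open QInfo in
  by_cases hne : Nonempty A₁ ∧ Nonempty A₂
  swap
  -- If an input system is zero-dimensional, the product system has no ensembles and the supremum on
  -- the left is over the empty set.
  · refine iSup_le fun E => absurd ?_ hne
    obtain ⟨ρ, hρ⟩ := exists_isDensity_of_ensemble E
    exact nonempty_prod.1 hρ.nonempty
  obtain ⟨hA₁, hA₂⟩ := hne
  have : Nonempty B₁ := (hNEB.isDensity maxMixed_isDensity).nonempty
  have : Nonempty B₂ := (hN.isDensity maxMixed_isDensity).nonempty
  have ht1 := alphaHolevo_ne_top (fun ρ => hNEB.isDensity (ρ := ρ)) h1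
  have ht2 := alphaHolevo_ne_top (fun ρ => hN.isDensity (ρ := ρ)) h1
  refine EReal.le_add_of_forall_gt (Or.inr ht2) (Or.inl ht1) fun a ha b hb => ?_
  obtain ⟨c, hc, hca⟩ := EReal.lt_iff_exists_real_btwn.1 ha
  obtain ⟨d, hd, hdb⟩ := EReal.lt_iff_exists_real_btwn.1 hb
  obtain ⟨σ, hσ, hσd, hσq⟩ := exists_posDef_of_alphaHolevo_lt
    (fun ρ => hNEB.isDensity (ρ := ρ)) h1 hc
  obtain ⟨τ, hτ, hτd, hτq⟩ := exists_posDef_of_alphaHolevo_lt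
    (fun ρ => hN.isDensity (ρ := ρ)) h1 hd
  have hst : IsDensity (Matrix.kroneckerMap (· * ·) σ τ) :=
    ⟨hσd.1.kronecker hτd.1, by rw [Matrix.trace_kronecker, hσd.2, hτd.2, one_mul]⟩
  -- The reference state σ ⊗ τ turns the product of the two quasi-entropy bounds into the sum c + d
  -- of exponents.
  have hle : alphaHolevo α (tensorMap NEB N) ≤ ((c + d : ℝ) : EReal) := by
    refine alphaHolevo_le (fun ρ hρ => ?_) h1 hst (hσ.kronecker hτ) fun ρ hρ => ?_
    · obtain ⟨k, M, L, hM, hL, hML⟩ := hNEB.1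
      rw [tensorMap_eq_sum hML]
      exact Matrix.posSemidef_sum _ fun x _ =>
        (hL x).kronecker (hN.1.posSemidef (condState_posSemidef (hM x) hρ.1))
    · refine (quasi_tensorMap_le hNEB.1 (fun X => hN.1.posSemidef) hσd.1 hτd.1 h1
        (by positivity) hσq hτq hρ).trans_eq ?_
      rw [← Real.rpow_add two_pos, ← mul_add]
  rw [EReal.coe_add] at hle
  exact hle.trans (add_le_add hca.le hdb.le)
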